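/- Let $d\ge 1$, $\mathcal X=[0,1]^d$, and consider the model $y=f^*(x)+\varepsilon$. For $\theta_1\ge 0$, $\theta_2>0$ let $H(\theta_1,\theta_2)$ be the set of $f:\mathcal X\to\mathbb R$ with $|f(x)-f(x')|\le\theta_1\|x-x'\|_2^{\theta_2}$ for all $x,x'\in\mathcal X$. Assume: (1) $f^*\in H(\theta_1^*,\theta_2^*)$ with $\theta_1^*\ge0$ and $0<\theta_2^*\le 1$; (2) given the covariates, the noises $\varepsilon_i$ are independent and sub-Gaussian (with a common variance proxy $K$), with mean zero and variance $\sigma^2(x_i)$, where $\sigma\ge 0$, $\sup_{\mathcal X}\sigma^2\le\sigma_{\max}^2$ for a constant $\sigma_{\max}>0$, and $\sigma\in H(\theta_1^{(\sigma)},\theta_2^{(\sigma)})$ with $\theta_1^{(\sigma)}\ge0$, $\theta_2^{(\sigma)}>0$. *Retrieval scheme.* Let $n\ge2$ be the sampling budget, $0<c<1$ a constant, $n_0=\lfloor cn\rfloor$, $h_\sigma=n^{-1/(d+2)}$ and $K_h(x,x')=\max\{0,h-\|x-x'\|_\infty\}$. Step 1: draw $x_1,\dots,x_{n_0}$ independently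 and uniformly from $\mathcal X$, observe $y_i=f^*(x_i)+\varepsilon_i$, and put, with sums over $1\le i\le\lfloor n_0/2\rfloor$, $$\hat\sigma^2(x)=\frac{\sum_i y_i^2K_{h_\sigma}(x_i,x)}{1\vee\sum_i K_{h_\sigma}(x_i,x)}-\frac{\{\sum_i y_iK_{h_\sigma}(x_i,x)\}^2}{1\vee\{\sum_i K_{h_\sigma}(x_i,x)\}^2}.$$ Step 2: conditionally on the data of Step 1, draw $x_{n_0+1},\dots,x_n$ independently from the density $\hat p_X=\hat\sigma/\int_{\mathcal X}\hat\sigma$ on $\mathcal X$ (from the uniform density if $\int_{\mathcal X}\hat\sigma=0$). Let $h=n^{-c_0}$ with a constant $c_0\ge0$, let $\bar\sigma=\int_{\mathcal X}\sigma(x)\,dx/|\mathcal X|$, and let $$r_n=\max\Big\{\sqrt{\sigma_{\max}\theta_1^{(\sigma)}h^{\theta_2^{(\sigma)}}},\ \frac{\sigma_{\max}\log n}{nh^d}\Big\},\qquad \tilde r_n=r_n+\log n\cdot n^{-\frac{\min(2\theta_2^*,\,\theta_2^{(\sigma)},\,1/2)}{4+2d}},\qquad \mathcal X_1=\{x\in\mathcal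 X:\sigma(x)\le c_r\tilde r_n\}.$$ Let $0<c_1<1$ be a constant and let $c_r$ be a sufficiently large constant. If $$|\mathcal X_1|\le c_1\min\Big\{\frac{\bar\sigma^2}{\tilde r_n^2\,n h^d},\,1\Big\},$$ then $$\int_{\mathcal X}\mathbb E\left[\frac{\sigma^2(x)+\sigma_{\max}\theta_1^{(\sigma)}h^{\theta_2^{(\sigma)}}}{\max\{1,n_h(x)\}}\right]dx\le C\,\frac{\bar\sigma^2}{nh^d}.$$ This holds both for $n_h(x)=\#\{1\le i\le n:\|x_i-x\|_\infty\le h\}$ and for the count restricted to the Step 2 points, $n_h(x)=\#\{n_0<i\le n:\|x_i-x\|_\infty\le h\}$. The lower threshold for $c_r$ depends only on $d$, $\sigma_{\max}$, $K$, $\theta_2^*$, $\theta_2^{(\sigma)}$, $c$, $c_0$, $c_1$ and an upper bound $L$ for $\theta_1^*$ and $\theta_1^{(\sigma)}$; the constant $C>0$ depends only on these and on $c_r$. In particular neither depends on $n$, $f^*$, $\sigma$ or the noise laws. -/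

import Mathlib

open MeasureTheory ProbabilityTheory
open scoped ENNReal NNReal

noncomputable section

namespace Retrieval

/-- Points of `ℝ^d`. The default norm on this type is the sup-norm, and `volume` is the
Lebesgue measure. -/
abbrev Pt (d : ℕ) : Type := Fin d → ℝ

/-- The Euclidean norm on `ℝ^d`. -/
def l2norm {d : ℕ} (v : Pt d) : ℝ := ‖(WithLp.toLp 2 v : EuclideanSpace ℝ (Fin d))‖

/-- The domain `𝒳 = [0,1]^d`. -/
def cube (d : ℕ) : Set (Pt d) := Set.Icc 0 1

/-- The Hölder class `H(θ₁, θ₂)` on `T ⊆ ℝ^d`, with respect to the Euclidean norm. -/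
def HolderClass {d : ℕ} (θ₁ θ₂ : ℝ) (T : Set (Pt d)) : Set (Pt d → ℝ) :=
  {f | ∀ x ∈ T, ∀ x' ∈ T, |f x - f x'| ≤ θ₁ * l2norm (x - x') ^ θ₂}

/-- The uniform distribution on `[0,1]^d`. -/
def uniformCube (d : ℕ) : Measure (Pt d) := volume.restrict (cube d)

/-- The heteroskedastic noise condition. `Q i x` is the conditional law of the `i`-th noise given
that the `i`-th covariate is `x`. It has mean zero, variance `σ(x)²`, and is sub-Gaussian with
variance proxy `K`, the same for all `i` and `x`. The standard deviation function `σ` is bounded by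
`σmax` and belongs to the Hölder class `H(θ₁, θ₂)`. -/
structure NoiseCondition {d : ℕ} (σmax : ℝ) (K : ℝ≥0) (θ₁ θ₂ : ℝ) (σ : Pt d → ℝ)
    (Q : ℕ → Kernel (Pt d) ℝ) : Prop where
  sd_nonneg : ∀ x ∈ cube d, 0 ≤ σ x
  variance_le : ∀ x ∈ cube d, σ x ^ 2 ≤ σmax ^ 2
  holder : σ ∈ HolderClass θ₁ θ₂ (cube d)
  mean_zero : ∀ i, ∀ x ∈ cube d, ∫ e, e ∂(Q i x) = 0
  variance_eq : ∀ i, ∀ x ∈ cube d, Var[id; Q i x] = σ x ^ 2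
  subGaussian : ∀ i, ∀ x ∈ cube d, HasSubgaussianMGF id K (Q i x)

/-- The kernel `K_h(x, x') = max{0, h - ‖x - x'‖_∞}`. -/
def tri {d : ℕ} (h : ℝ) (x x' : Pt d) : ℝ := max 0 (h - ‖x - x'‖)

/-- The kernel variance estimate `σ̂²(x)` with bandwidth `b`, computed from the labelled points
`(X i, Y i)`, `i < m`. -/
def varEst {d : ℕ} (b : ℝ) (m : ℕ) (X : ℕ → Pt d) (Y : ℕ → ℝ) (x : Pt d) : ℝ :=
  (∑ i ∈ Finset.range m, Y i ^ 2 * tri b (X i) x) /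
      max 1 (∑ i ∈ Finset.range m, tri b (X i) x)
    - (∑ i ∈ Finset.range m, Y i * tri b (X i) x) ^ 2 /
      max 1 ((∑ i ∈ Finset.range m, tri b (X i) x) ^ 2)

/-- The estimated standard deviation `σ̂(x)`. -/
def sdEst {d : ℕ} (b : ℝ) (m : ℕ) (X : ℕ → Pt d) (Y : ℕ → ℝ) (x : Pt d) : ℝ :=
  Real.sqrt (varEst b m X Y x)

/-- The distribution on `[0,1]^d` with density `g / ∫ g`; if `∫ g = 0`, so that this density is
undefined, the uniform distribution is used. -/
def normalizedLaw {d : ℕ} (g : Pt d → ℝ) : Measure (Pt d) :=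
  open Classical in
  if ∫ x in cube d, g x = 0 then uniformCube d
  else (uniformCube d).withDensity
    (fun x => ENNReal.ofReal (g x / ∫ x' in cube d, g x'))

/-- The size `n₀ = ⌊c n⌋` of the first-step sample. -/
def pilotSize (c : ℝ) (n : ℕ) : ℕ := ⌊c * n⌋₊

/-- The variance-estimation bandwidth `h_σ = n^{-1/(d+2)}`. -/
def sdBandwidth (d n : ℕ) : ℝ := (n : ℝ) ^ (-(1 / ((d : ℝ) + 2)))

/-- The retrieval distribution `p̂_X` with density `σ̂ / ∫ σ̂`, as a function of the covariates `X`
and noises `E` of the first step; the responses are `Y i = f (X i) + E i`, and the first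
`n₀ / 2` points are used. -/
def retrievalLaw {d : ℕ} (c : ℝ) (n : ℕ) (f : Pt d → ℝ) (X : ℕ → Pt d) (E : ℕ → ℝ) :
    Measure (Pt d) :=
  normalizedLaw
    (sdEst (sdBandwidth d n) (pilotSize c n / 2) X (fun i => f (X i) + E i))

/-- The covariates and noises of the first `m` samples. -/
def firstData {d : ℕ} {Ω : Type*} (m : ℕ) (x : ℕ → Ω → Pt d) (ε : ℕ → Ω → ℝ) (ω : Ω) :
    Fin m → Pt d × ℝ :=
  fun i => (x i ω, ε i ω)

/-- Extension of a finite data set by zeros, so that it can be indexed by `ℕ`; only the indices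
below `m` are ever used. -/
def extend {α : Type*} [Zero α] {m : ℕ} (D : Fin m → α) (i : ℕ) : α :=
  if hi : i < m then D ⟨i, hi⟩ else 0

/-- `x i`, `ε i` (`i < n`) are the covariates and noises produced by the two-step retrieval scheme
with sampling budget `n` (indices start at `0`).

Step 1: the pairs `(x i, ε i)`, `i < n₀`, are independent, `x i` is uniform on `[0,1]^d`, and given
`x i` the noise `ε i` has law `Q i (x i)`.

Step 2: conditionally on the data `D` of Step 1, the pairs `(x j, ε j)`, `n₀ ≤ j < n`, are
independent, `x j` has law `p̂_X` (computed from `D`), and given `x j` the noise `ε j` has law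
`Q j (x j)`. -/
structure IsRetrievalSample {d : ℕ} {Ω : Type*} [MeasurableSpace Ω] (P : Measure Ω)
    (c : ℝ) (n : ℕ) (f : Pt d → ℝ) (Q : ℕ → Kernel (Pt d) ℝ)
    (x : ℕ → Ω → Pt d) (ε : ℕ → Ω → ℝ) : Prop where
  measurable_x : ∀ i < n, Measurable (x i)
  measurable_ε : ∀ i < n, Measurable (ε i)
  first_step : P.map (firstData (pilotSize c n) x ε) =
    Measure.pi (fun i : Fin (pilotSize c n) => (uniformCube d) ⊗ₘ (Q i))
  second_step : ∀ A : Set (Fin (pilotSize c n) → Pt d × ℝ), MeasurableSet A →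
    ∀ B : ℕ → Set (Pt d × ℝ), (∀ j, MeasurableSet (B j)) →
      P {ω | firstData (pilotSize c n) x ε ω ∈ A ∧
          ∀ j ∈ Finset.Ico (pilotSize c n) n, (x j ω, ε j ω) ∈ B j} =
        ∫⁻ D in A, ∏ j ∈ Finset.Ico (pilotSize c n) n,
            (retrievalLaw c n f (fun i => (extend D i).1) (fun i => (extend D i).2) ⊗ₘ Q j) (B j)
          ∂(P.map (firstData (pilotSize c n) x ε))

/-- The number of covariates with index in `N` in the sup-norm ball of radius `h` around `z`:
`n_h(z) = ∑_{i ∈ N} 1(‖x_i - z‖_∞ ≤ h)`. -/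
def localCount {d : ℕ} (N : Finset ℕ) (X : ℕ → Pt d) (h : ℝ) (z : Pt d) : ℕ :=
  open Classical in (N.filter (fun i => ‖X i - z‖ ≤ h)).card

/-- The average noise level `σ̄ = ∫_𝒳 σ / |𝒳|`. -/
def avgSd {d : ℕ} (σ : Pt d → ℝ) : ℝ := (∫ x in cube d, σ x) / volume.real (cube d)

/-- `r_n = max{ √(σmax θ₁ h^θ₂), σmax log n / (n h^d) }`. -/
def rate (d n : ℕ) (σmax θ₁ θ₂ h : ℝ) : ℝ :=
  max (Real.sqrt (σmax * θ₁ * h ^ θ₂)) (σmax * Real.log n / (n * h ^ d))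

/-- `r̃_n = r_n + log n · n^{-min(2 θ₂*, θ₂, 1/2) / (4 + 2 d)}`; here `τ` stands for the Hölder
exponent `θ₂*` of the regression function. -/
def rateTilde (d n : ℕ) (σmax τ θ₁ θ₂ h : ℝ) : ℝ :=
  rate d n σmax θ₁ θ₂ h +
    Real.log n * (n : ℝ) ^ (-(min (2 * τ) (min θ₂ (1 / 2)) / (4 + 2 * (d : ℝ))))

/-- The low-noise region `{x ∈ 𝒳 : σ(x) ≤ t}`. -/
def lowNoise {d : ℕ} (σ : Pt d → ℝ) (t : ℝ) : Set (Pt d) := {x ∈ cube d | σ x ≤ t}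

/-- The variance term
`∫_𝒳 E[(σ²(z) + σmax θ₁ h^θ₂) / max{1, n_h(z)}] dz`, the integral of a nonnegative function, where
`n_h` counts the covariates with index in `N`. -/
def varianceTerm {d : ℕ} {Ω : Type*} [MeasurableSpace Ω] (P : Measure Ω)
    (x : ℕ → Ω → Pt d) (N : Finset ℕ) (σ : Pt d → ℝ) (σmax θ₁ θ₂ h : ℝ) : ℝ≥0∞ :=
  ∫⁻ z in cube d, ∫⁻ ω,
    ENNReal.ofReal ((σ z ^ 2 + σmax * θ₁ * h ^ θ₂) /
      max 1 (localCount N (fun i => x i ω) h z : ℝ)) ∂P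

end Retrieval

end

open Retrieval

noncomputable section

namespace Retrieval

/-! ### The cube, Hölder functions, the triangular kernel, and regularity of the estimator. -/

section

variable {d : ℕ}

/-! If the retrieval density were exactly `σ / ∫ σ`, a ball of radius `h` around `z` would have mass
of order `σ(z) h^d / σ̄`. The number of Step 2 points in it is binomial, so its inverse (truncated
at one) has mean of order `σ̄ / (n σ(z) h^d)`. Multiplying by `σ(z)²` and integrating gives `σ̄² /
(n h^d)`. The proof shows that the estimated density is good enough for this wherever `σ` exceeds
`c_r r̃_n`. The remaining set is handled by its volume: there the numerator is `O(r̃_n²)`, and the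
volume hypothesis is exactly what makes the product `O(σ̄² / (n h^d))`.

For the estimator, write the variance estimate as a weighted variance. The weighted standard
deviation is a seminorm, so the regression function contributes only its local oscillation
(`abs_sdEst_sub_sqrt_wVar_le`), and the noise part is within the stochastic error of `σ²`
(`abs_sdEst_sub_le`). Exponential moments of the noise and of its centred square control that error
at each fixed point.

No uniform bound over the cube is attempted. By Markov and Tonelli (`measure_volume_slice_ge_le`)
the points where the noise averages deviate fill, with probability `1 - O(n⁻³)`, a set `V` of volume
below `n⁻³`. Off `V` the error is `O(log n · n^{-β/(4+2d)})` with `β = min(2θ₂*, θ₂^{(σ)}, 1/2)`; on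
`V` a crude bound of order `n²` suffices, because it adds only `O(1/n)` to the normalizing integral
(`GoodPilot.le_normalizedLaw_sdEst_ball`).

The bound `c₁ < 1` on the low-noise volume gives `σ̄ ≥ (1 - c₁) c_r r̃_n`. Hence the estimation
error and the `1/n` term are both `O(σ̄)`, and the failure probability `O(n⁻³)` is `O(σ̄² / (n
h^d))`. Budgets below a fixed threshold are covered by the trivial bound and a larger constant. -/

lemma measurableSet_cube : MeasurableSet (cube d) := measurableSet_Icc

lemma volume_cube : volume (cube d) = 1 := by
  rw [cube, Real.volume_Icc_pi]
  simp

instance : IsProbabilityMeasure (uniformCube d) :=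
  ⟨by rw [uniformCube, Measure.restrict_apply_univ, volume_cube]⟩

lemma avgSd_eq (σ : Pt d → ℝ) : avgSd σ = ∫ x in cube d, σ x := by
  simp [avgSd, Measure.real, volume_cube]

lemma l2norm_le (v : Pt d) : l2norm v ≤ Real.sqrt d * ‖v‖ := by
  rw [l2norm, EuclideanSpace.norm_eq]
  rw [← Real.sqrt_sq (norm_nonneg v), ← Real.sqrt_mul (by positivity)]
  apply Real.sqrt_le_sqrt
  calc ∑ i, ‖v i‖ ^ 2 ≤ ∑ _i : Fin d, ‖v‖ ^ 2 :=
        Finset.sum_le_sum fun i _ => by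
          have := norm_le_pi_norm v i
          gcongr
    _ = d * ‖v‖ ^ 2 := by simp

lemma l2norm_nonneg (v : Pt d) : 0 ≤ l2norm v := norm_nonneg _

/-- The volume of a sup-norm ball centred in the cube, intersected with the cube. -/
lemma pow_le_uniformCube_ball {z : Pt d} (hz : z ∈ cube d) {r : ℝ} (hr : 0 ≤ r) (hr1 : r ≤ 1) :
    ENNReal.ofReal (r ^ d) ≤ uniformCube d {x | ‖x - z‖ ≤ r} := by
  have hsub : Set.Icc (fun i => max 0 (z i - r)) (fun i => max 0 (z i - r) + r) ⊆
      {x : Pt d | ‖x - z‖ ≤ r} ∩ cube d := by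
    intro x hx
    have hx1 := hx.1
    have hx2 := hx.2
    refine ⟨?_, fun i => ?_, fun i => ?_⟩
    · show ‖x - z‖ ≤ r
      refine (pi_norm_le_iff_of_nonneg hr).2 fun i => ?_
      have h1 := hx1 i
      have h2 := hx2 i
      have h3 := hz.1 i
      have := le_max_right 0 (z i - r)
      have : max 0 (z i - r) ≤ z i := max_le h3 (by linarith)
      simp only [Pi.sub_apply, Real.norm_eq_abs, abs_le] at *
      constructor <;> linarith
    · exact (le_max_left _ _).trans (hx1 i)
    · have h2 := hx2 i
      have h3 := hz.2 i
      have : max 0 (z i - r) ≤ 1 - r := max_le (by linarith) (by simp at h3; linarith)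
      simp only [Pi.one_apply] at *
      linarith
  have hmeas : MeasurableSet {x : Pt d | ‖x - z‖ ≤ r} :=
    measurableSet_le (by fun_prop) (by fun_prop)
  rw [uniformCube, Measure.restrict_apply hmeas]
  refine le_trans (le_of_eq ?_) (measure_mono hsub)
  rw [Real.volume_Icc_pi]
  simp [ENNReal.ofReal_pow hr]

lemma HolderClass.abs_sub_le {θ₁ θ₂ L : ℝ} {f : Pt d → ℝ} (hf : f ∈ HolderClass θ₁ θ₂ (cube d))
    (hθ₁ : 0 ≤ θ₁) (hL : θ₁ ≤ L) (hθ₂ : 0 ≤ θ₂) {x y : Pt d} (hx : x ∈ cube d) (hy : y ∈ cube d)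
    {r : ℝ} (hr : ‖x - y‖ ≤ r) : |f x - f y| ≤ L * (Real.sqrt d * r) ^ θ₂ := by
  refine (hf x hx y hy).trans ?_
  have h0 := l2norm_nonneg (x - y)
  have h1 : l2norm (x - y) ≤ Real.sqrt d * r := (l2norm_le _).trans (by gcongr)
  have := Real.rpow_le_rpow h0 h1 hθ₂
  have h2 := Real.rpow_nonneg h0 θ₂
  exact mul_le_mul hL this h2 (hθ₁.trans hL)

lemma HolderClass.continuousOn {θ₁ θ₂ : ℝ} {f : Pt d → ℝ} (hf : f ∈ HolderClass θ₁ θ₂ (cube d))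
    (hθ₁ : 0 ≤ θ₁) (hθ₂ : 0 < θ₂) : ContinuousOn f (cube d) := by
  intro x hx
  have hlim : Filter.Tendsto (fun y => θ₁ * (Real.sqrt d * ‖y - x‖) ^ θ₂)
      (nhdsWithin x (cube d)) (nhds 0) := by
    have : ContinuousAt (fun y : Pt d => θ₁ * (Real.sqrt d * ‖y - x‖) ^ θ₂) x := by
      refine continuousAt_const.mul (ContinuousAt.rpow_const (by fun_prop) (Or.inr hθ₂.le))
    have h2 := this.tendsto.mono_left (nhdsWithin_le_nhds (s := cube d))
    simpa [Real.zero_rpow hθ₂.ne'] using h2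
  refine tendsto_iff_dist_tendsto_zero.2 (squeeze_zero' (Filter.Eventually.of_forall fun _ => dist_nonneg) ?_ hlim)
  filter_upwards [self_mem_nhdsWithin] with y hy
  rw [Real.dist_eq]
  exact HolderClass.abs_sub_le hf hθ₁ le_rfl hθ₂.le hy hx le_rfl

lemma tri_nonneg (h : ℝ) (x y : Pt d) : 0 ≤ tri h x y := le_max_left _ _

lemma tri_le {h : ℝ} (hh : 0 ≤ h) (x y : Pt d) : tri h x y ≤ h :=
  max_le hh (by linarith [norm_nonneg (x - y)])

lemma norm_sub_le_of_tri_pos {h : ℝ} {x y : Pt d} (hxy : tri h x y ≠ 0) : ‖x - y‖ ≤ h := by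
  by_contra hlt
  exact hxy (max_eq_left (by linarith))

lemma continuous_tri (h : ℝ) : Continuous fun p : Pt d × Pt d => tri h p.1 p.2 := by
  unfold tri
  fun_prop

lemma continuous_varEst (b : ℝ) (m : ℕ) (X : ℕ → Pt d) (Y : ℕ → ℝ) :
    Continuous (varEst b m X Y) := by
  have htri : ∀ i, Continuous fun x => tri b (X i) x := fun i =>
    (continuous_tri b).comp (continuous_const.prodMk continuous_id)
  unfold varEst
  refine Continuous.sub (Continuous.div (by fun_prop) (by fun_prop) fun x => ?_)
    (Continuous.div (by fun_prop) (by fun_prop) fun x => ?_)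
  all_goals exact (lt_of_lt_of_le one_pos (le_max_left _ _)).ne'

lemma continuous_sdEst (b : ℝ) (m : ℕ) (X : ℕ → Pt d) (Y : ℕ → ℝ) :
    Continuous (sdEst b m X Y) :=
  Real.continuous_sqrt.comp (continuous_varEst b m X Y)

lemma integrableOn_cube_of_continuousOn {g : Pt d → ℝ} (hg : ContinuousOn g (cube d)) :
    IntegrableOn g (cube d) :=
  hg.integrableOn_compact isCompact_Icc

lemma isProbabilityMeasure_normalizedLaw {g : Pt d → ℝ} (hg : Continuous g) (hg0 : ∀ x, 0 ≤ g x) :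
    IsProbabilityMeasure (normalizedLaw g) := by
  unfold normalizedLaw
  split_ifs with h
  · infer_instance
  · have hint := integrableOn_cube_of_continuousOn hg.continuousOn
    refine ⟨?_⟩
    rw [withDensity_apply _ MeasurableSet.univ, Measure.restrict_univ,
      ← ofReal_integral_eq_lintegral_ofReal, integral_div]
    · rw [uniformCube, div_self h, ENNReal.ofReal_one]
    · exact hint.div_const _
    · exact Filter.Eventually.of_forall fun x =>
        div_nonneg (hg0 x) (integral_nonneg fun x => hg0 x)

instance (c : ℝ) (n : ℕ) (f : Pt d → ℝ) (X : ℕ → Pt d) (E : ℕ → ℝ) :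
    IsProbabilityMeasure (retrievalLaw c n f X E) :=
  isProbabilityMeasure_normalizedLaw (continuous_sdEst _ _ _ _) fun _ => Real.sqrt_nonneg _

end

/-! ### Deterministic error analysis of the variance estimator. -/

section

section WeightedVariance

variable {ι : Type*} (s : Finset ι) (w y : ι → ℝ)

/-- The variance of `y` under the weights `w`. -/
def wVar : ℝ :=
  (∑ i ∈ s, w i * y i ^ 2) / (∑ i ∈ s, w i) - ((∑ i ∈ s, w i * y i) / (∑ i ∈ s, w i)) ^ 2

variable {s w y}

/-- The centred form exhibits the variance as a squared weighted norm; nonnegativity, shift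
invariance and the triangle inequality are read off from it. -/
lemma wVar_eq (hS : 0 < ∑ i ∈ s, w i) :
    wVar s w y =
      (∑ i ∈ s, w i * (y i - (∑ j ∈ s, w j * y j) / ∑ j ∈ s, w j) ^ 2) / ∑ i ∈ s, w i := by
  set S := ∑ i ∈ s, w i with hSdef
  set a := (∑ j ∈ s, w j * y j) / S with ha
  have h1 : ∑ i ∈ s, w i * (y i - a) ^ 2 =
      (∑ i ∈ s, w i * y i ^ 2) - 2 * a * (∑ i ∈ s, w i * y i) + a ^ 2 * S := by
    rw [hSdef, Finset.mul_sum, Finset.mul_sum, ← Finset.sum_sub_distrib, ← Finset.sum_add_distrib]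
    exact Finset.sum_congr rfl fun i _ => by ring
  have h2 : ∑ j ∈ s, w j * y j = a * S := by rw [ha]; field_simp
  rw [h1, wVar, ← hSdef, ← ha, h2]
  field_simp
  ring

lemma wVar_nonneg (hw : ∀ i ∈ s, 0 ≤ w i) (hS : 0 < ∑ i ∈ s, w i) : 0 ≤ wVar s w y := by
  rw [wVar_eq hS]
  exact div_nonneg (Finset.sum_nonneg fun i hi => mul_nonneg (hw i hi) (sq_nonneg _)) hS.le

lemma wVar_neg : wVar s w (fun i => -y i) = wVar s w y := by
  simp [wVar, neg_div]

lemma wVar_add_const (a : ℝ) (hS : 0 < ∑ i ∈ s, w i) :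
    wVar s w (fun i => y i + a) = wVar s w y := by
  rw [wVar_eq hS, wVar_eq hS]
  congr 1
  refine Finset.sum_congr rfl fun i _ => ?_
  have : (∑ j ∈ s, w j * (y j + a)) = (∑ j ∈ s, w j * y j) + (∑ j ∈ s, w j) * a := by
    rw [Finset.sum_mul, ← Finset.sum_add_distrib]
    exact Finset.sum_congr rfl fun i _ => by ring
  rw [this, add_div, mul_div_cancel_left₀ _ hS.ne']
  ring

/-- Minkowski's inequality, from Cauchy–Schwarz on the cross term. -/
lemma sqrt_sum_add_sq_le (u v : ι → ℝ) :
    Real.sqrt (∑ i ∈ s, (u i + v i) ^ 2) ≤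
      Real.sqrt (∑ i ∈ s, u i ^ 2) + Real.sqrt (∑ i ∈ s, v i ^ 2) := by
  apply Real.sqrt_le_iff.2
  refine ⟨by positivity, ?_⟩
  have hu : 0 ≤ ∑ i ∈ s, u i ^ 2 := Finset.sum_nonneg fun i _ => sq_nonneg _
  have hv : 0 ≤ ∑ i ∈ s, v i ^ 2 := Finset.sum_nonneg fun i _ => sq_nonneg _
  have hcs := Real.sum_mul_le_sqrt_mul_sqrt s u v
  have : ∑ i ∈ s, (u i + v i) ^ 2 =
      (∑ i ∈ s, u i ^ 2) + 2 * (∑ i ∈ s, u i * v i) + ∑ i ∈ s, v i ^ 2 := by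
    rw [Finset.mul_sum, ← Finset.sum_add_distrib, ← Finset.sum_add_distrib]
    exact Finset.sum_congr rfl fun i _ => by ring
  rw [this, add_sq, Real.sq_sqrt hu, Real.sq_sqrt hv]
  linarith

/-- The standard deviation under the weights `w` is a seminorm. -/
lemma sqrt_wVar_add_le (hw : ∀ i ∈ s, 0 ≤ w i) (hS : 0 < ∑ i ∈ s, w i) (y z : ι → ℝ) :
    Real.sqrt (wVar s w (fun i => y i + z i)) ≤
      Real.sqrt (wVar s w y) + Real.sqrt (wVar s w z) := by
  have key := sqrt_sum_add_sq_le (s := s)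
    (fun i => Real.sqrt (w i) * (y i - (∑ j ∈ s, w j * y j) / ∑ j ∈ s, w j))
    (fun i => Real.sqrt (w i) * (z i - (∑ j ∈ s, w j * z j) / ∑ j ∈ s, w j))
  have e (x : ι → ℝ) : ∑ i ∈ s, (Real.sqrt (w i) * x i) ^ 2 = ∑ i ∈ s, w i * x i ^ 2 :=
    Finset.sum_congr rfl fun i hi => by rw [mul_pow, Real.sq_sqrt (hw i hi)]
  simp only [← mul_add] at key
  rw [e, e, e] at key
  rw [wVar_eq hS, wVar_eq hS, wVar_eq hS, Real.sqrt_div' _ hS.le, Real.sqrt_div' _ hS.le,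
    Real.sqrt_div' _ hS.le, ← add_div]
  refine div_le_div_of_nonneg_right (le_trans (le_of_eq ?_) key) (Real.sqrt_nonneg _)
  congr 1
  refine Finset.sum_congr rfl fun i _ => ?_
  have : (∑ j ∈ s, w j * (y j + z j)) = (∑ j ∈ s, w j * y j) + (∑ j ∈ s, w j * z j) := by
    rw [← Finset.sum_add_distrib]
    exact Finset.sum_congr rfl fun i _ => by ring
  rw [this, add_div]
  ring

/-- Reverse triangle inequality. With `y` the increments of the regression function and `z` the
noise, it bounds the bias without any cross term to control. -/
lemma abs_sqrt_wVar_add_sub_le (hw : ∀ i ∈ s, 0 ≤ w i) (hS : 0 < ∑ i ∈ s, w i) (y z : ι → ℝ) :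
    |Real.sqrt (wVar s w (fun i => y i + z i)) - Real.sqrt (wVar s w z)| ≤
      Real.sqrt (wVar s w y) := by
  rw [abs_le]
  have h1 := sqrt_wVar_add_le hw hS y z
  have h2 := sqrt_wVar_add_le hw hS (fun i => y i + z i) (fun i => -y i)
  simp only [wVar_neg, add_neg_cancel_comm] at h2
  constructor <;> linarith

lemma wVar_le_of_abs_le (hw : ∀ i ∈ s, 0 ≤ w i) (hS : 0 < ∑ i ∈ s, w i) {δ : ℝ}
    (hy : ∀ i ∈ s, w i ≠ 0 → |y i| ≤ δ) : wVar s w y ≤ δ ^ 2 := by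
  have h1 : (∑ i ∈ s, w i * y i ^ 2) / (∑ i ∈ s, w i) ≤ δ ^ 2 := by
    rw [div_le_iff₀ hS, Finset.mul_sum]
    refine Finset.sum_le_sum fun i hi => ?_
    by_cases h0 : w i = 0
    · simp [h0]
    · rw [mul_comm]
      exact mul_le_mul_of_nonneg_right (sq_le_sq' (abs_le.1 (hy i hi h0)).1
        (abs_le.1 (hy i hi h0)).2) (hw i hi)
  have := sq_nonneg ((∑ i ∈ s, w i * y i) / (∑ i ∈ s, w i))
  unfold wVar
  linarith

end WeightedVariance

/-- Since `|√a - b| ≤ √a + b`, the square of the left side is at most `|a - b²|`. No lower bound on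
`b` is needed, so the estimate survives where `σ` vanishes; the price is a square root of the
variance error, which halves the exponent in the rate. -/
lemma abs_sqrt_sub_le_sqrt_abs {a b : ℝ} (ha : 0 ≤ a) (hb : 0 ≤ b) :
    |Real.sqrt a - b| ≤ Real.sqrt |a - b ^ 2| := by
  apply Real.le_sqrt_of_sq_le
  have hs := Real.sqrt_nonneg a
  have e : a - b ^ 2 = (Real.sqrt a - b) * (Real.sqrt a + b) := by
    nth_rewrite 1 [← Real.sq_sqrt ha]; ring
  rw [e, abs_mul, sq]
  refine mul_le_mul_of_nonneg_left ?_ (abs_nonneg _)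
  rw [abs_of_nonneg (by positivity : 0 ≤ Real.sqrt a + b), abs_le]
  constructor <;> linarith

variable {d : ℕ}

/-- Once the total weight is at least one, both truncations `1 ∨ ·` are inactive. -/
lemma varEst_eq_wVar {b : ℝ} {m : ℕ} {X : ℕ → Pt d} {Y : ℕ → ℝ} {x : Pt d}
    (hS : 1 ≤ ∑ i ∈ Finset.range m, tri b (X i) x) :
    varEst b m X Y x = wVar (Finset.range m) (fun i => tri b (X i) x) Y := by
  have h2 : 1 ≤ (∑ i ∈ Finset.range m, tri b (X i) x) ^ 2 := one_le_pow₀ hS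
  rw [varEst, wVar, max_eq_right hS, max_eq_right h2, div_pow]
  simp only [mul_comm]

/-- Shifting all responses by `-f x` leaves the variance unchanged and turns them into noise plus
increments of `f` that are at most `δ` wherever the weight is nonzero. -/
lemma abs_sdEst_sub_sqrt_wVar_le {b : ℝ} {m : ℕ} {X : ℕ → Pt d} {E : ℕ → ℝ} {x : Pt d}
    {f : Pt d → ℝ} {δ : ℝ} (hδ : 0 ≤ δ)
    (hS : 1 ≤ ∑ i ∈ Finset.range m, tri b (X i) x)
    (hf : ∀ i < m, ‖X i - x‖ ≤ b → |f (X i) - f x| ≤ δ) :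
    |sdEst b m X (fun i => f (X i) + E i) x -
      Real.sqrt (wVar (Finset.range m) (fun i => tri b (X i) x) E)| ≤ δ := by
  have hS0 : 0 < ∑ i ∈ Finset.range m, tri b (X i) x := by linarith
  have hw : ∀ i ∈ Finset.range m, 0 ≤ tri b (X i) x := fun i _ => tri_nonneg _ _ _
  rw [sdEst, varEst_eq_wVar hS, ← wVar_add_const (-f x) hS0]
  have := abs_sqrt_wVar_add_sub_le hw hS0 (fun i => f (X i) - f x) E
  have e : (fun i => f (X i) + E i + -f x) = fun i => f (X i) - f x + E i := by
    ext i; ring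
  rw [e]
  refine this.trans (Real.sqrt_le_iff.2 ⟨hδ, wVar_le_of_abs_le hw hS0 fun i hi h0 => ?_⟩)
  exact hf i (Finset.mem_range.1 hi) (norm_sub_le_of_tri_pos h0)

/-- On the event that the local averages of the noises and of the centred squared noises are small,
the estimated standard deviation is close to the true one. -/
lemma abs_sdEst_sub_le {b : ℝ} {m : ℕ} {X : ℕ → Pt d} {E : ℕ → ℝ} {x : Pt d}
    {f σ : Pt d → ℝ} {δ δ' t : ℝ} (hδ : 0 ≤ δ) (hσ : 0 ≤ σ x)
    (hS : 1 ≤ ∑ i ∈ Finset.range m, tri b (X i) x)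
    (hf : ∀ i < m, ‖X i - x‖ ≤ b → |f (X i) - f x| ≤ δ)
    (hσδ : ∀ i < m, ‖X i - x‖ ≤ b → |σ (X i) ^ 2 - σ x ^ 2| ≤ δ')
    (h1 : |∑ i ∈ Finset.range m, tri b (X i) x * E i| ≤
      t * ∑ i ∈ Finset.range m, tri b (X i) x)
    (h2 : |∑ i ∈ Finset.range m, tri b (X i) x * (E i ^ 2 - σ (X i) ^ 2)| ≤
      t * ∑ i ∈ Finset.range m, tri b (X i) x) :
    |sdEst b m X (fun i => f (X i) + E i) x - σ x| ≤ δ + Real.sqrt (t + δ' + t ^ 2) := by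
  have hS0 : 0 < ∑ i ∈ Finset.range m, tri b (X i) x := by linarith
  have hw : ∀ i ∈ Finset.range m, 0 ≤ tri b (X i) x := fun i _ => tri_nonneg _ _ _
  have hA := abs_sdEst_sub_sqrt_wVar_le (E := E) hδ hS hf
  have hB := abs_sqrt_sub_le_sqrt_abs (wVar_nonneg (y := E) hw hS0) hσ
  have hC : |wVar (Finset.range m) (fun i => tri b (X i) x) E - σ x ^ 2| ≤ t + δ' + t ^ 2 := by
    set S := ∑ i ∈ Finset.range m, tri b (X i) x with hSdef
    -- Three errors: fluctuation of the squared noises, oscillation of `σ²` over the window, and the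
    -- square of the averaged noise.
    have e : wVar (Finset.range m) (fun i => tri b (X i) x) E - σ x ^ 2 =
        (∑ i ∈ Finset.range m, tri b (X i) x * (E i ^ 2 - σ (X i) ^ 2)) / S +
        (∑ i ∈ Finset.range m, tri b (X i) x * (σ (X i) ^ 2 - σ x ^ 2)) / S -
        ((∑ i ∈ Finset.range m, tri b (X i) x * E i) / S) ^ 2 := by
      have : σ x ^ 2 = (∑ i ∈ Finset.range m, tri b (X i) x * σ x ^ 2) / S := by
        rw [← Finset.sum_mul, ← hSdef]; field_simp
      nth_rewrite 1 [this]
      rw [wVar, ← hSdef, sub_right_comm, ← sub_div, ← add_div, ← Finset.sum_sub_distrib,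
        ← Finset.sum_add_distrib]
      congr 2
      refine Finset.sum_congr rfl fun i _ => by ring
    have b1 : |(∑ i ∈ Finset.range m, tri b (X i) x * (E i ^ 2 - σ (X i) ^ 2)) / S| ≤ t := by
      rw [abs_div, abs_of_pos hS0, div_le_iff₀ hS0]; exact h2
    have b3 : |(∑ i ∈ Finset.range m, tri b (X i) x * E i) / S| ≤ t := by
      rw [abs_div, abs_of_pos hS0, div_le_iff₀ hS0]; exact h1
    have b2 : |(∑ i ∈ Finset.range m, tri b (X i) x * (σ (X i) ^ 2 - σ x ^ 2)) / S| ≤ δ' := by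
      rw [abs_div, abs_of_pos hS0, div_le_iff₀ hS0]
      refine (Finset.abs_sum_le_sum_abs _ _).trans ?_
      rw [hSdef, Finset.mul_sum]
      refine Finset.sum_le_sum fun i hi => ?_
      rw [abs_mul, abs_of_nonneg (hw i hi), mul_comm]
      by_cases h0 : tri b (X i) x = 0
      · simp [h0]
      · exact mul_le_mul_of_nonneg_right
          (hσδ i (Finset.mem_range.1 hi) (norm_sub_le_of_tri_pos h0)) (hw i hi)
    have b4 : ((∑ i ∈ Finset.range m, tri b (X i) x * E i) / S) ^ 2 ≤ t ^ 2 :=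
      sq_le_sq' (abs_le.1 b3).1 (abs_le.1 b3).2
    have b5 := sq_nonneg ((∑ i ∈ Finset.range m, tri b (X i) x * E i) / S)
    rw [e, abs_le]
    rw [abs_le] at b1 b2
    have := sq_nonneg t
    constructor <;> linarith
  have hD := hB.trans (Real.sqrt_le_sqrt hC)
  rw [abs_le] at *
  constructor <;> linarith

/-- A crude bound on the estimated standard deviation. -/
lemma sdEst_le {b : ℝ} {m : ℕ} {X : ℕ → Pt d} {E : ℕ → ℝ} {x : Pt d}
    {f : Pt d → ℝ} {δ : ℝ} (hδ : 0 ≤ δ)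
    (hS : 1 ≤ ∑ i ∈ Finset.range m, tri b (X i) x)
    (hf : ∀ i < m, ‖X i - x‖ ≤ b → |f (X i) - f x| ≤ δ) :
    sdEst b m X (fun i => f (X i) + E i) x ≤
      δ + Real.sqrt (∑ i ∈ Finset.range m, E i ^ 2) := by
  have hA := abs_sdEst_sub_sqrt_wVar_le (E := E) hδ hS hf
  have hS0 : 0 < ∑ i ∈ Finset.range m, tri b (X i) x := by linarith
  have hw : ∀ i ∈ Finset.range m, 0 ≤ tri b (X i) x := fun i _ => tri_nonneg _ _ _
  have hB : wVar (Finset.range m) (fun i => tri b (X i) x) E ≤ ∑ i ∈ Finset.range m, E i ^ 2 := by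
    have h1 : (∑ i ∈ Finset.range m, tri b (X i) x * E i ^ 2) /
        (∑ i ∈ Finset.range m, tri b (X i) x) ≤ ∑ i ∈ Finset.range m, E i ^ 2 := by
      rw [div_le_iff₀ hS0, Finset.sum_mul]
      refine Finset.sum_le_sum fun i hi => ?_
      rw [mul_comm]
      exact mul_le_mul_of_nonneg_left (Finset.single_le_sum hw hi) (sq_nonneg _)
    have := sq_nonneg ((∑ i ∈ Finset.range m, tri b (X i) x * E i) /
      (∑ i ∈ Finset.range m, tri b (X i) x))
    unfold wVar
    linarith
  have := Real.sqrt_le_sqrt hB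
  rw [abs_le] at hA
  linarith

end

/-! ### Exponential moments of sub-Gaussian noise and of its square. -/

section

section SubGaussianSquare

/-- A sub-Gaussian variable has a finite exponential moment of its square. -/
lemma lintegral_exp_sq_le {K : ℝ≥0} {μ : Measure ℝ} [IsProbabilityMeasure μ]
    (hμ : HasSubgaussianMGF id K μ) :
    ∫⁻ e, ENNReal.ofReal (Real.exp (e ^ 2 / (4 * (K + 1)))) ∂μ ≤ 2 := by
  have hK : (0 : ℝ) < K + 1 := by positivity
  -- the Gaussian law with variance `1 / (2 (K + 1))`
  set v : ℝ≥0 := 1 / (2 * (K + 1)) with hv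
  have hvr : (v : ℝ) = 1 / (2 * (K + 1)) := by simp [hv]
  have hv0 : v ≠ 0 := by rw [hv]; positivity
  -- Gaussian linearization: the exponential of a square is a Gaussian average of exponentials of
  -- linear terms, so after exchanging integrals only the moment generating function of the noise is
  -- needed. Using `K + 1` in place of `K` keeps the Gaussian variance finite when `K = 0`.
  have h1 : ∀ e : ℝ, ENNReal.ofReal (Real.exp (e ^ 2 / (4 * (K + 1)))) =
      ∫⁻ g, ENNReal.ofReal (Real.exp (e * g)) ∂(gaussianReal 0 v) := by
    intro e
    rw [← ofReal_integral_eq_lintegral_ofReal (integrable_exp_mul_gaussianReal e)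
      (Filter.Eventually.of_forall fun _ => (Real.exp_pos _).le)]
    have := congrFun (mgf_id_gaussianReal (μ := 0) (v := v)) e
    simp only [mgf, id] at this
    rw [this, hvr]
    congr 2
    field_simp
    ring
  simp_rw [h1]
  rw [lintegral_lintegral_swap (by fun_prop)]
  have h2 : ∀ g : ℝ, ∫⁻ e, ENNReal.ofReal (Real.exp (e * g)) ∂μ ≤
      ENNReal.ofReal (Real.exp ((K + 1) * g ^ 2 / 2)) := by
    intro g
    simp_rw [mul_comm _ g]
    have hint : Integrable (fun e => Real.exp (g * e)) μ := hμ.integrable_exp_mul g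
    rw [← ofReal_integral_eq_lintegral_ofReal hint
      (Filter.Eventually.of_forall fun _ => (Real.exp_pos _).le)]
    refine ENNReal.ofReal_le_ofReal ((hμ.mgf_le g).trans (Real.exp_le_exp.2 ?_))
    nlinarith [sq_nonneg g]
  refine (lintegral_mono h2).trans ?_
  rw [gaussianReal_of_var_ne_zero _ hv0, lintegral_withDensity_eq_lintegral_mul _ (by fun_prop) (by fun_prop)]
  -- The exponential factor halves the Gaussian exponent, which doubles the variance; the ratio of
  -- normalizing constants is `√2`.
  have h3 : ∀ g : ℝ, (gaussianPDF 0 v * fun g => ENNReal.ofReal (Real.exp ((K + 1) * g ^ 2 / 2))) g =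
      ENNReal.ofReal (Real.sqrt 2) * gaussianPDF 0 (2 * v) g := by
    intro g
    simp only [Pi.mul_apply, gaussianPDF, gaussianPDFReal]
    rw [← ENNReal.ofReal_mul (by positivity), ← ENNReal.ofReal_mul (by positivity)]
    congr 1
    push_cast
    rw [hvr, mul_assoc, ← Real.exp_add, ← mul_assoc]
    congr 1
    · rw [show 2 * Real.pi * (2 * (1 / (2 * ((K : ℝ) + 1)))) = 2 * (2 * Real.pi * (1 / (2 * (K + 1)))) by ring,
        Real.sqrt_mul (by norm_num) (2 * Real.pi * (1 / (2 * ((K : ℝ) + 1))))]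
      have : Real.sqrt 2 ≠ 0 := by positivity
      field_simp
    · congr 1
      field_simp
      ring
  simp_rw [h3]
  rw [lintegral_const_mul _ (by fun_prop), lintegral_gaussianPDF_eq_one _ (by positivity), mul_one]
  rw [← ENNReal.ofReal_ofNat 2]
  apply ENNReal.ofReal_le_ofReal
  rw [Real.sqrt_le_iff]
  norm_num

/-- Second-order Taylor for `|y| ≤ 1`; beyond that `y² ≥ 1` makes the last term dominate. The linear
term is kept exactly because it cancels after centring. -/
lemma exp_le_one_add_add_sq_mul (y : ℝ) : Real.exp y ≤ 1 + y + y ^ 2 * Real.exp |y| := by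
  rcases le_or_gt |y| 1 with h | h
  · have h1 := (abs_le.1 (Real.abs_exp_sub_one_sub_id_le h)).2
    have h2 : 1 ≤ Real.exp |y| := Real.one_le_exp (abs_nonneg y)
    nlinarith [sq_nonneg y]
  · rcases le_or_gt 0 y with hy | hy
    · rw [abs_of_nonneg hy] at *
      have : 1 ≤ y ^ 2 := one_le_pow₀ h.le
      nlinarith [Real.exp_pos y]
    · have h2 : 1 ≤ Real.exp |y| := Real.one_le_exp (abs_nonneg y)
      have h3 : Real.exp y ≤ 1 := Real.exp_le_one_iff.2 hy.le
      rw [abs_of_neg hy] at *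
      nlinarith [sq_nonneg y]

/-- The centred square of a sub-Gaussian variable is sub-exponential. -/
lemma lintegral_exp_mul_sq_sub_le {K : ℝ≥0} {μ : Measure ℝ} [IsProbabilityMeasure μ]
    (hμ : HasSubgaussianMGF id K μ) (hμ0 : ∫ e, e ∂μ = 0) {s : ℝ} (hs : |s| ≤ 1 / (8 * (K + 1))) :
    ∫⁻ e, ENNReal.ofReal (Real.exp (s * (e ^ 2 - Var[id; μ]))) ∂μ ≤
      ENNReal.ofReal (Real.exp (256 * (K + 1) ^ 2 * s ^ 2)) := by
  have hK : (0 : ℝ) < K + 1 := by positivity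
  set W : ℝ → ℝ := fun e => Real.exp (e ^ 2 / (4 * (K + 1))) with hW
  have hWint : Integrable W μ := by
    refine ⟨by fun_prop, ?_⟩
    rw [hasFiniteIntegral_iff_ofReal (Filter.Eventually.of_forall fun _ => (Real.exp_pos _).le)]
    exact (lintegral_exp_sq_le hμ).trans_lt (by norm_num)
  have hW2 : ∫ e, W e ∂μ ≤ 2 := by
    have := lintegral_exp_sq_le hμ
    rw [← ofReal_integral_eq_lintegral_ofReal hWint
      (Filter.Eventually.of_forall fun _ => (Real.exp_pos _).le)] at this
    rw [← ENNReal.ofReal_ofNat 2] at this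
    exact (ENNReal.ofReal_le_ofReal_iff (by norm_num)).1 this
  have hvar : Var[id; μ] = ∫ e, e ^ 2 ∂μ := by
    rw [variance_of_integral_eq_zero aemeasurable_id (by simpa using hμ0)]
    rfl
  have hsq : Integrable (fun e : ℝ => e ^ 2) μ := by
    have := (hμ.memLp 2).integrable_sq
    simpa using this
  -- With `u = e² / (8(K+1))`, the bound on `s` gives `|s e²| ≤ u`; moreover `(s e²)² = 128 (K+1)²
  -- s² · u²/2`, `u²/2 ≤ exp u`, and `W = exp(2u)`.
  have hpt : ∀ e : ℝ, Real.exp (s * e ^ 2) ≤ 1 + s * e ^ 2 + s ^ 2 * (128 * (K + 1) ^ 2) * W e := by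
    intro e
    refine (exp_le_one_add_add_sq_mul _).trans ?_
    set u := e ^ 2 / (8 * (K + 1)) with hu
    have hu0 : 0 ≤ u := by positivity
    have h1 : |s * e ^ 2| ≤ u := by
      rw [abs_mul, abs_of_nonneg (sq_nonneg e), hu, div_eq_mul_one_div, mul_comm]
      exact mul_le_mul_of_nonneg_left hs (sq_nonneg e)
    have h2 : u ^ 2 / 2 ≤ Real.exp u := by
      have := Real.pow_div_factorial_le_exp u hu0 2
      simpa using this
    have h3 : W e = Real.exp u * Real.exp u := by
      rw [← Real.exp_add]
      refine congrArg Real.exp ?_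
      rw [hu]; field_simp; ring
    have h4 : (s * e ^ 2) ^ 2 = s ^ 2 * (128 * (K + 1) ^ 2) * (u ^ 2 / 2) := by
      rw [hu]; field_simp; ring
    rw [h4, h3, ← mul_assoc (_ * _) (Real.exp u)]
    refine add_le_add_right (mul_le_mul ?_ (Real.exp_le_exp.2 h1) (Real.exp_pos _).le ?_) _
    · exact mul_le_mul_of_nonneg_left h2 (by positivity)
    · positivity
  have hexp : Integrable (fun e => Real.exp (s * e ^ 2)) μ :=
    Integrable.mono' (((integrable_const _).add (hsq.const_mul s)).add (hWint.const_mul _))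
      (by fun_prop) (Filter.Eventually.of_forall fun e => by
        rw [Real.norm_of_nonneg (Real.exp_pos _).le]; exact hpt e)
  have hI : ∫ e, Real.exp (s * e ^ 2) ∂μ ≤
      Real.exp (s * Var[id; μ] + 256 * (K + 1) ^ 2 * s ^ 2) := by
    calc ∫ e, Real.exp (s * e ^ 2) ∂μ
        ≤ ∫ e, (1 + s * e ^ 2 + s ^ 2 * (128 * (K + 1) ^ 2) * W e) ∂μ :=
          integral_mono hexp
            (((integrable_const _).add (hsq.const_mul s)).add (hWint.const_mul _)) hpt
      _ = 1 + s * Var[id; μ] + s ^ 2 * (128 * (K + 1) ^ 2) * ∫ e, W e ∂μ := by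
          have h0 : Integrable (fun e : ℝ => 1 + s * e ^ 2) μ :=
            (integrable_const _).add (hsq.const_mul s)
          rw [integral_add h0 (hWint.const_mul _),
            integral_add (integrable_const _) (hsq.const_mul s), integral_const_mul,
            integral_const_mul, hvar]
          simp
      _ ≤ (s * Var[id; μ] + 256 * (K + 1) ^ 2 * s ^ 2) + 1 := by
          have : s ^ 2 * (128 * (K + 1) ^ 2) * ∫ e, W e ∂μ ≤ s ^ 2 * (128 * (K + 1) ^ 2) * 2 :=
            mul_le_mul_of_nonneg_left hW2 (by positivity)
          linarith
      _ ≤ _ := Real.add_one_le_exp _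
  have e1 : ∀ e : ℝ, Real.exp (s * (e ^ 2 - Var[id; μ])) =
      Real.exp (-(s * Var[id; μ])) * Real.exp (s * e ^ 2) := fun e => by
    rw [← Real.exp_add]; congr 1; ring
  simp_rw [e1]
  rw [← ofReal_integral_eq_lintegral_ofReal (hexp.const_mul _)
    (Filter.Eventually.of_forall fun _ => by positivity), integral_const_mul]
  apply ENNReal.ofReal_le_ofReal
  calc _ ≤ Real.exp (-(s * Var[id; μ])) * Real.exp (s * Var[id; μ] + 256 * (K + 1) ^ 2 * s ^ 2) :=
        mul_le_mul_of_nonneg_left hI (Real.exp_pos _).le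
    _ = _ := by rw [← Real.exp_add]; congr 1; ring

/-- The constant is far from sharp; it is chosen equal to the one for centred squares so that both
noise sums obey the same tail bound. -/
lemma lintegral_exp_mul_le {K : ℝ≥0} {μ : Measure ℝ} [IsProbabilityMeasure μ]
    (hμ : HasSubgaussianMGF id K μ) (s : ℝ) :
    ∫⁻ e, ENNReal.ofReal (Real.exp (s * e)) ∂μ ≤
      ENNReal.ofReal (Real.exp (256 * (K + 1) ^ 2 * s ^ 2)) := by
  have hint : Integrable (fun e => Real.exp (s * e)) μ := hμ.integrable_exp_mul s
  rw [← ofReal_integral_eq_lintegral_ofReal hint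
    (Filter.Eventually.of_forall fun _ => (Real.exp_pos _).le)]
  refine ENNReal.ofReal_le_ofReal ((hμ.mgf_le s).trans (Real.exp_le_exp.2 ?_))
  have hK := K.2
  have : (K : ℝ) / 2 ≤ 256 * (K + 1) ^ 2 := by nlinarith [K.coe_nonneg]
  nlinarith [sq_nonneg s]

end SubGaussianSquare

end

/-! ### Exponential tails over product measures, and volumes of bad slices. -/

section

section Extend

variable {α : Type*} [Zero α] {k m : ℕ}

lemma extend_of_lt (D : Fin k → α) {i : ℕ} (hi : i < k) : extend D i = D ⟨i, hi⟩ := dif_pos hi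

variable [MeasurableSpace α]

lemma measurable_extend (i : ℕ) : Measurable fun D : Fin k → α => extend D i := by
  unfold extend
  split_ifs <;> fun_prop

lemma lintegral_comp_extend (μ : Fin k → Measure α) [∀ i, IsProbabilityMeasure (μ i)]
    {i : ℕ} (hi : i < k) {ψ : α → ℝ≥0∞} (hψ : Measurable ψ) :
    ∫⁻ D, ψ (extend D i) ∂(Measure.pi μ) = ∫⁻ a, ψ a ∂(μ ⟨i, hi⟩) := by
  simp_rw [extend_of_lt _ hi]
  exact (measurePreserving_eval μ ⟨i, hi⟩).lintegral_comp hψ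

lemma lintegral_prod_extend (μ : Fin k → Measure α) [∀ i, IsProbabilityMeasure (μ i)]
    (hm : m ≤ k) {ψ : α → ℝ≥0∞} (hψ : Measurable ψ) {C : ℝ≥0∞}
    (hC : ∀ i, ∫⁻ a, ψ a ∂(μ i) ≤ C) :
    ∫⁻ D, ∏ i ∈ Finset.range m, ψ (extend D i) ∂(Measure.pi μ) ≤ C ^ m := by
  have hind : iIndepFun (fun (i : Fin k) (D : Fin k → α) => ψ (D i)) (Measure.pi μ) :=
    iIndepFun_pi (X := fun _ => ψ) fun i => hψ.aemeasurable
  have h1 : ∀ D : Fin k → α, ∏ i ∈ Finset.range m, ψ (extend D i) =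
      ∏ i : Fin k with i.1 < m, ψ (D i) := by
    intro D
    refine (Finset.prod_bij (fun i _ => i.1) ?_ ?_ ?_ ?_).symm
    · intro i hi; simpa using hi
    · intro i _ j _ h; exact Fin.ext h
    · intro i hi
      have := Finset.mem_range.1 hi
      exact ⟨⟨i, by omega⟩, by simpa using this, rfl⟩
    · intro i _
      rw [extend_of_lt D i.2]
  simp_rw [h1]
  rw [lintegral_prod_eq_prod_lintegral_of_indepFun _ (fun (i : Fin k) (D : Fin k → α) => ψ (D i)) hind (fun i => hψ.comp (measurable_pi_apply i))]
  have h2 : ∀ i : Fin k, ∫⁻ D, ψ (D i) ∂(Measure.pi μ) ≤ C := fun i =>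
    ((measurePreserving_eval μ i).lintegral_comp hψ).trans_le (hC i)
  have hcard : (Finset.univ.filter fun i : Fin k => i.1 < m).card = m := by
    rw [Fin.card_filter_val_lt]; exact min_eq_right hm
  refine (Finset.prod_le_prod' fun i _ => h2 i).trans ?_
  rw [Finset.prod_const, hcard]

/-- Markov's inequality in exponential form. -/
lemma measure_ge_le_of_lintegral_exp_le {β : Type*} [MeasurableSpace β] (μ : Measure β)
    {g : β → ℝ} (hg : Measurable g) {A : ℝ}
    (h : ∫⁻ x, ENNReal.ofReal (Real.exp (g x)) ∂μ ≤ ENNReal.ofReal (Real.exp A)) (a : ℝ) :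
    μ {x | a ≤ g x} ≤ ENNReal.ofReal (Real.exp (A - a)) := by
  have h1 := mul_meas_ge_le_lintegral (μ := μ) (f := fun x => ENNReal.ofReal (Real.exp (g x)))
    (by fun_prop) (ENNReal.ofReal (Real.exp a))
  have h2 : {x | a ≤ g x} = {x | ENNReal.ofReal (Real.exp a) ≤ ENNReal.ofReal (Real.exp (g x))} := by
    ext x
    show a ≤ g x ↔ ENNReal.ofReal (Real.exp a) ≤ ENNReal.ofReal (Real.exp (g x))
    rw [ENNReal.ofReal_le_ofReal_iff (Real.exp_pos _).le, Real.exp_le_exp]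
  rw [← h2] at h1
  have h3 := h1.trans h
  rw [mul_comm, ← ENNReal.le_div_iff_mul_le (Or.inl (by positivity)) (Or.inl ENNReal.ofReal_ne_top)] at h3
  rwa [← ENNReal.ofReal_div_of_pos (Real.exp_pos _), ← Real.exp_sub] at h3

/-- Exponential tail bound for a sum over independent data. -/
lemma measure_sum_ge_le (μ : Fin k → Measure α) [∀ i, IsProbabilityMeasure (μ i)]
    (hm : m ≤ k) {φ : α → ℝ} (hφ : Measurable φ) {A : ℝ}
    (hA : ∀ i, ∫⁻ a, ENNReal.ofReal (Real.exp (φ a)) ∂(μ i) ≤ ENNReal.ofReal (Real.exp A)) (a : ℝ) :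
    Measure.pi μ {D | a ≤ ∑ i ∈ Finset.range m, φ (extend D i)} ≤
      ENNReal.ofReal (Real.exp (m * A - a)) := by
  refine measure_ge_le_of_lintegral_exp_le _ ?_ ?_ a
  · exact Finset.measurable_sum _ fun i _ => hφ.comp (measurable_extend i)
  · have := lintegral_prod_extend (m := m) μ hm (ψ := fun a => ENNReal.ofReal (Real.exp (φ a)))
      (by fun_prop) hA
    simp_rw [Real.exp_sum, ENNReal.ofReal_prod_of_nonneg fun _ _ => (Real.exp_pos _).le]
    refine this.trans (le_of_eq ?_)
    rw [← ENNReal.ofReal_pow (Real.exp_pos _).le, ← Real.exp_nat_mul]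

end Extend

/-- If each slice of `T` over the cube has small probability, then with high probability the other
slices have small volume. -/
lemma measure_volume_slice_ge_le {d : ℕ} {β : Type*} [MeasurableSpace β] (μ : Measure β)
    [SFinite μ] {T : Set (β × Pt d)} (hT : MeasurableSet T) {ε η : ℝ≥0∞} (hη : η ≠ 0) (hη' : η ≠ ∞)
    (h : ∀ z ∈ cube d, μ {D | (D, z) ∈ T} ≤ ε) :
    μ {D | η ≤ uniformCube d {z | (D, z) ∈ T}} ≤ ε / η := by
  -- Markov for the volume of the slice; Tonelli then identifies its mean with the integral over `z`
  -- of the pointwise probabilities. This replaces a union bound over a net.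
  have h1 := mul_meas_ge_le_lintegral (μ := μ) (f := fun D => uniformCube d (Prod.mk D ⁻¹' T))
    (measurable_measure_prodMk_left hT) η
  rw [ENNReal.le_div_iff_mul_le (Or.inl hη) (Or.inl hη'), mul_comm]
  refine h1.trans ?_
  rw [← Measure.prod_apply hT, Measure.prod_apply_symm hT]
  calc ∫⁻ z, μ ((fun D => (D, z)) ⁻¹' T) ∂(uniformCube d)
      ≤ ∫⁻ _z, ε ∂(uniformCube d) := by
        refine lintegral_mono_ae ?_
        rw [uniformCube, ae_restrict_iff' measurableSet_cube]
        exact Filter.Eventually.of_forall h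
    _ = ε := by simp

end

/-! ### Concentration for the first-step sample. -/

section

variable {d k m : ℕ} {Q : ℕ → Kernel (Pt d) ℝ} [∀ i, IsMarkovKernel (Q i)]

/-- The law of the first `k` samples. -/
def pilotLaw (k : ℕ) (Q : ℕ → Kernel (Pt d) ℝ) : Measure (Fin k → Pt d × ℝ) :=
  Measure.pi fun i => (uniformCube d) ⊗ₘ (Q i)

instance : IsProbabilityMeasure (pilotLaw k Q) := by
  unfold pilotLaw; infer_instance

lemma lintegral_uniformCube_compProd_le {i : ℕ} {ψ : Pt d × ℝ → ℝ≥0∞} (hψ : Measurable ψ) {C : ℝ≥0∞}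
    (h : ∀ x ∈ cube d, ∫⁻ e, ψ (x, e) ∂(Q i x) ≤ C) :
    ∫⁻ p, ψ p ∂(uniformCube d ⊗ₘ Q i) ≤ C := by
  rw [Measure.lintegral_compProd hψ]
  calc ∫⁻ x, ∫⁻ e, ψ (x, e) ∂(Q i x) ∂(uniformCube d) ≤ ∫⁻ _x, C ∂(uniformCube d) := by
        refine lintegral_mono_ae ?_
        rw [uniformCube, ae_restrict_iff' measurableSet_cube]
        exact Filter.Eventually.of_forall h
    _ = C := by simp

lemma pilotLaw_exists_notMem_cube :
    pilotLaw k Q {D | ∃ i, (D i).1 ∉ cube d} = 0 := by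
  have : {D : Fin k → Pt d × ℝ | ∃ i, (D i).1 ∉ cube d} = ⋃ i, {D | (D i).1 ∉ cube d} := by
    ext D; simp
  rw [this, measure_iUnion_null_iff]
  intro i
  have hA : MeasurableSet {p : Pt d × ℝ | p.1 ∉ cube d} :=
    (measurableSet_cube.preimage measurable_fst).compl
  have h1 := (measurePreserving_eval (fun i : Fin k => (uniformCube d) ⊗ₘ (Q i)) i).measure_preimage
    hA.nullMeasurableSet
  refine h1.trans ?_
  have hfst : (uniformCube d ⊗ₘ Q i) (Prod.fst ⁻¹' (cube d)ᶜ) = uniformCube d (cube d)ᶜ := by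
    rw [← Measure.fst_apply measurableSet_cube.compl, Measure.fst_compProd]
  refine hfst.trans ?_
  rw [uniformCube, Measure.restrict_apply measurableSet_cube.compl]
  simp

/-- Tail bound for a locally weighted sum of noise terms. -/
lemma pilotLaw_weighted_sum_ge_le (hm : m ≤ k) {b : ℝ} (hb : 0 ≤ b) (hb1 : b ≤ 1)
    {ζ : Pt d × ℝ → ℝ} (hζ : Measurable ζ) {s₀ v : ℝ} (hs₀ : 0 ≤ s₀)
    (h : ∀ i, ∀ x ∈ cube d, ∀ s, |s| ≤ s₀ →
      ∫⁻ e, ENNReal.ofReal (Real.exp (s * ζ (x, e))) ∂(Q i x) ≤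
        ENNReal.ofReal (Real.exp (v * s ^ 2))) (z : Pt d) (a : ℝ) :
    pilotLaw k Q {D | a + v * s₀ ^ 2 * ∑ i ∈ Finset.range m, tri b (extend D i).1 z ^ 2 ≤
        s₀ * |∑ i ∈ Finset.range m, tri b (extend D i).1 z * ζ (extend D i)|} ≤
      2 * ENNReal.ofReal (Real.exp (-a)) := by
  have htri : Measurable fun p : Pt d × ℝ => tri b p.1 z :=
    ((continuous_tri b).comp (continuous_fst.prodMk continuous_const)).measurable
  -- Conditionally on the covariate, subtracting `v s² w²` makes each exponential moment at most
  -- one. The compensator stays random, so no concentration of the sum of squared weights is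
  -- required. The two signs of `s` give the absolute value.
  have main : ∀ s, |s| = s₀ → pilotLaw k Q {D | a ≤ ∑ i ∈ Finset.range m,
      (s * tri b (extend D i).1 z * ζ (extend D i) - v * s ^ 2 * tri b (extend D i).1 z ^ 2)} ≤
      ENNReal.ofReal (Real.exp (-a)) := by
    intro s hs
    have := measure_sum_ge_le (m := m) (fun i : Fin k => (uniformCube d) ⊗ₘ (Q i)) hm
      (φ := fun p => s * tri b p.1 z * ζ p - v * s ^ 2 * tri b p.1 z ^ 2) (by fun_prop) (A := 0)
      (fun i => ?_) a
    · rwa [mul_zero, zero_sub] at this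
    · refine lintegral_uniformCube_compProd_le (by fun_prop) fun x hx => ?_
      have hw0 := tri_nonneg b x z
      have hw1 := (tri_le hb x z).trans hb1
      have hsw : |s * tri b x z| ≤ s₀ := by
        rw [abs_mul, hs, abs_of_nonneg hw0]
        exact mul_le_of_le_one_right hs₀ hw1
      have h1 := h i x hx _ hsw
      have e1 : ∀ e : ℝ, ENNReal.ofReal (Real.exp (s * tri b x z * ζ (x, e) -
          v * s ^ 2 * tri b x z ^ 2)) = ENNReal.ofReal (Real.exp (s * tri b x z * ζ (x, e))) *
          ENNReal.ofReal (Real.exp (-(v * (s * tri b x z) ^ 2))) := fun e => by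
        rw [← ENNReal.ofReal_mul (Real.exp_pos _).le, ← Real.exp_add]
        congr 2
        ring
      simp_rw [e1]
      rw [lintegral_mul_const _ (by fun_prop)]
      refine (mul_le_mul_left h1 _).trans (le_of_eq ?_)
      rw [← ENNReal.ofReal_mul (Real.exp_pos _).le, ← Real.exp_add, add_neg_cancel]
  have hsub : {D : Fin k → Pt d × ℝ | a + v * s₀ ^ 2 * ∑ i ∈ Finset.range m,
      tri b (extend D i).1 z ^ 2 ≤
      s₀ * |∑ i ∈ Finset.range m, tri b (extend D i).1 z * ζ (extend D i)|} ⊆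
      {D | a ≤ ∑ i ∈ Finset.range m, (s₀ * tri b (extend D i).1 z * ζ (extend D i) -
        v * s₀ ^ 2 * tri b (extend D i).1 z ^ 2)} ∪
      {D | a ≤ ∑ i ∈ Finset.range m, (-s₀ * tri b (extend D i).1 z * ζ (extend D i) -
        v * (-s₀) ^ 2 * tri b (extend D i).1 z ^ 2)} := by
    intro D hD
    have hD' : a + v * s₀ ^ 2 * ∑ i ∈ Finset.range m, tri b (extend D i).1 z ^ 2 ≤
      s₀ * |∑ i ∈ Finset.range m, tri b (extend D i).1 z * ζ (extend D i)| := hD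
    have e (s : ℝ) : ∑ i ∈ Finset.range m, (s * tri b (extend D i).1 z * ζ (extend D i) -
        v * s ^ 2 * tri b (extend D i).1 z ^ 2) =
        s * (∑ i ∈ Finset.range m, tri b (extend D i).1 z * ζ (extend D i)) -
        v * s ^ 2 * ∑ i ∈ Finset.range m, tri b (extend D i).1 z ^ 2 := by
      rw [Finset.sum_sub_distrib, Finset.mul_sum, Finset.mul_sum]
      simp only [mul_assoc]
    rcases abs_cases (∑ i ∈ Finset.range m, tri b (extend D i).1 z * ζ (extend D i)) with h0 | h0
    · left
      show a ≤ _
      rw [e]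
      rw [h0.1] at hD'
      linarith
    · right
      show a ≤ _
      rw [e, neg_sq]
      rw [h0.1] at hD'
      linarith
  refine (measure_mono hsub).trans ((measure_union_le _ _).trans ?_)
  rw [two_mul]
  exact add_le_add (main s₀ (abs_of_nonneg hs₀)) (main (-s₀) (by rw [abs_neg, abs_of_nonneg hs₀]))

open Classical in
/-- The number of the first `m` covariates within distance `r` of `z`, as a real number. -/
def ballCount (m : ℕ) (r : ℝ) (X : ℕ → Pt d) (z : Pt d) : ℝ :=
  ∑ i ∈ Finset.range m, if ‖X i - z‖ ≤ r then 1 else 0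

/-- Lower tail bound for the number of covariates near a point. -/
lemma pilotLaw_ballCount_lt_le (hm : m ≤ k) {r : ℝ} (hr : 0 ≤ r) (hr1 : r ≤ 1) {z : Pt d}
    (hz : z ∈ cube d) (a : ℝ) :
    pilotLaw k Q {D | ballCount m r (fun i => (extend D i).1) z < a} ≤
      ENNReal.ofReal (Real.exp (a - m * (r ^ d / 2))) := by
  classical
  have hB : MeasurableSet {p : Pt d × ℝ | ‖p.1 - z‖ ≤ r} :=
    measurableSet_le (by fun_prop) (by fun_prop)
  have hB' : MeasurableSet {x : Pt d | ‖x - z‖ ≤ r} := measurableSet_le (by fun_prop) (by fun_prop)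
  have hφ : Measurable fun p : Pt d × ℝ => -(if ‖p.1 - z‖ ≤ r then (1 : ℝ) else 0) :=
    (Measurable.ite hB measurable_const measurable_const).neg
  have := measure_sum_ge_le (m := m) (fun i : Fin k => (uniformCube d) ⊗ₘ (Q i)) hm
      (φ := fun p => -(if ‖p.1 - z‖ ≤ r then (1 : ℝ) else 0)) hφ (A := -(r ^ d / 2))
      (fun i => ?_) (-a)
  · refine (measure_mono fun D hD => ?_).trans (this.trans (le_of_eq ?_))
    · have hD' : ballCount m r (fun i => (extend D i).1) z < a := hD
      show -a ≤ _
      rw [Finset.sum_neg_distrib]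
      unfold ballCount at hD'
      linarith
    · congr 2; ring
  · set μ := (uniformCube d) ⊗ₘ (Q i) with hμ
    set p : ℝ := μ.real {p : Pt d × ℝ | ‖p.1 - z‖ ≤ r} with hp
    have hpr : r ^ d ≤ p := by
      have h1 := pow_le_uniformCube_ball hz hr hr1
      have h2 : μ {p : Pt d × ℝ | ‖p.1 - z‖ ≤ r} = uniformCube d {x | ‖x - z‖ ≤ r} := by
        have : μ (Prod.fst ⁻¹' {x : Pt d | ‖x - z‖ ≤ r}) = uniformCube d {x | ‖x - z‖ ≤ r} := by
          rw [← Measure.fst_apply hB', hμ, Measure.fst_compProd]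
        exact this
      rw [hp, Measure.real, h2]
      exact (ENNReal.ofReal_le_iff_le_toReal (measure_ne_top _ _)).1 h1
    have hint : Integrable ({p : Pt d × ℝ | ‖p.1 - z‖ ≤ r}.indicator fun _ => (1 : ℝ)) μ :=
      (integrable_const 1).indicator hB
    -- Since `exp(-1) < 1/2`, the exponential lies below `1 - 1_B / 2`, whose mean `1 - p/2` is at
    -- most `exp(-p/2)`.
    have hpt : ∀ q : Pt d × ℝ, Real.exp (-(if ‖q.1 - z‖ ≤ r then (1 : ℝ) else 0)) ≤
        1 - {p : Pt d × ℝ | ‖p.1 - z‖ ≤ r}.indicator (fun _ => (1 : ℝ)) q / 2 := by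
      intro q
      by_cases hq : ‖q.1 - z‖ ≤ r
      · rw [if_pos hq, Set.indicator_of_mem (show q ∈ {p : Pt d × ℝ | ‖p.1 - z‖ ≤ r} from hq)]
        have := Real.exp_neg_one_lt_half
        linarith
      · rw [if_neg hq, Set.indicator_of_notMem (show q ∉ {p : Pt d × ℝ | ‖p.1 - z‖ ≤ r} from hq)]
        simp
    have hnn : ∀ q : Pt d × ℝ,
        0 ≤ 1 - {p : Pt d × ℝ | ‖p.1 - z‖ ≤ r}.indicator (fun _ => (1 : ℝ)) q / 2 :=
      fun q => (Real.exp_pos _).le.trans (hpt q)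
    calc _ ≤ ∫⁻ q, ENNReal.ofReal (1 -
          {p : Pt d × ℝ | ‖p.1 - z‖ ≤ r}.indicator (fun _ => (1 : ℝ)) q / 2) ∂μ :=
          lintegral_mono fun q => ENNReal.ofReal_le_ofReal (hpt q)
      _ = ENNReal.ofReal (1 - p / 2) := by
          have hint' : Integrable (fun q => 1 -
              {p : Pt d × ℝ | ‖p.1 - z‖ ≤ r}.indicator (fun _ => (1 : ℝ)) q / 2) μ :=
            (integrable_const _).sub (hint.div_const 2)
          rw [← ofReal_integral_eq_lintegral_ofReal hint'
            (Filter.Eventually.of_forall hnn), integral_sub (integrable_const _) (hint.div_const 2),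
            integral_div, integral_indicator_const _ hB]
          simp [hp]
      _ ≤ _ := by
          apply ENNReal.ofReal_le_ofReal
          have := Real.add_one_le_exp (-(p / 2))
          have h3 := Real.exp_le_exp.2 (show -(p / 2) ≤ -(r ^ d / 2) by linarith)
          linarith

/-- Chebyshev-type bound for the energy of the noise. -/
lemma pilotLaw_energy_gt_le (hm : m ≤ k) {σmax : ℝ}
    (h : ∀ i, ∀ x ∈ cube d, ∫⁻ e, ENNReal.ofReal (e ^ 2) ∂(Q i x) ≤ ENNReal.ofReal (σmax ^ 2))
    {a : ℝ} (ha : 0 < a) :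
    pilotLaw k Q {D | a < ∑ i ∈ Finset.range m, (extend D i).2 ^ 2} ≤
      ENNReal.ofReal (m * σmax ^ 2 / a) := by
  have hmeas : ∀ i, Measurable fun D : Fin k → Pt d × ℝ => (extend D i).2 ^ 2 := fun i =>
    (measurable_snd.comp (measurable_extend i)).pow_const 2
  have h1 := mul_meas_ge_le_lintegral (μ := pilotLaw k Q)
    (f := fun D => ENNReal.ofReal (∑ i ∈ Finset.range m, (extend D i).2 ^ 2))
    (Finset.measurable_sum _ fun i _ => hmeas i).ennreal_ofReal (ENNReal.ofReal a)
  have h2 : ∫⁻ D, ENNReal.ofReal (∑ i ∈ Finset.range m, (extend D i).2 ^ 2) ∂(pilotLaw k Q) ≤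
      ENNReal.ofReal (m * σmax ^ 2) := by
    simp_rw [ENNReal.ofReal_sum_of_nonneg fun _ _ => sq_nonneg _]
    rw [lintegral_finsetSum _ fun i _ => (hmeas i).ennreal_ofReal]
    refine (Finset.sum_le_sum (g := fun _ => ENNReal.ofReal (σmax ^ 2)) fun i hi => ?_).trans
      (le_of_eq ?_)
    · have hik : i < k := (Finset.mem_range.1 hi).trans_le hm
      have := lintegral_comp_extend (fun i : Fin k => (uniformCube d) ⊗ₘ (Q i)) hik
        (ψ := fun p => ENNReal.ofReal (p.2 ^ 2)) (by fun_prop)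
      refine this.trans_le ?_
      exact lintegral_uniformCube_compProd_le (by fun_prop) (h i)
    · simp [ENNReal.ofReal_mul]
  rw [ENNReal.ofReal_div_of_pos ha, ENNReal.le_div_iff_mul_le (Or.inl (by simpa using ha))
    (Or.inl ENNReal.ofReal_ne_top), mul_comm]
  refine le_trans ?_ (h1.trans h2)
  gcongr with D
  exact fun hD => ENNReal.ofReal_le_ofReal hD.le

end

/-! ### Good first-step data and their probability. -/

section

variable {d k m n : ℕ} {Q : ℕ → Kernel (Pt d) ℝ}

/-- The points at which a local average of the noises, or of the centred squared noises, deviates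
too much from its mean. -/
def noiseDeviation (b : ℝ) (m : ℕ) (K : ℝ≥0) (a : ℝ) (σ : Pt d → ℝ) (X : ℕ → Pt d) (E : ℕ → ℝ) :
    Set (Pt d) :=
  {z | a + 4 * ∑ i ∈ Finset.range m, tri b (X i) z ^ 2 ≤
      1 / (8 * (K + 1)) * |∑ i ∈ Finset.range m, tri b (X i) z * E i|} ∪
  {z | a + 4 * ∑ i ∈ Finset.range m, tri b (X i) z ^ 2 ≤
      1 / (8 * (K + 1)) * |∑ i ∈ Finset.range m, tri b (X i) z * (E i ^ 2 - σ (X i) ^ 2)|}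

/-- First-step data for which the estimated standard deviation is accurate. -/
structure GoodPilot (b : ℝ) (m n : ℕ) (K : ℝ≥0) (k₀ : ℝ) (σ : Pt d → ℝ) (X : ℕ → Pt d)
    (E : ℕ → ℝ) : Prop where
  mem_cube : ∀ i < m, X i ∈ cube d
  count : uniformCube d {z | ballCount m (b / 4) X z < k₀} < ENNReal.ofReal ((b / 4) ^ d)
  noise : uniformCube d (noiseDeviation b m K (6 * Real.log n) σ X E) <
    ENNReal.ofReal (1 / (n : ℝ) ^ 3)
  energy : ∑ i ∈ Finset.range m, E i ^ 2 ≤ (n : ℝ) ^ 4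

/-- Outside the cube `σ` is arbitrary; this allows passing to a measurable version and back. -/
lemma GoodPilot.congr {b : ℝ} {K : ℝ≥0} {k₀ : ℝ} {σ σ' : Pt d → ℝ} {X : ℕ → Pt d} {E : ℕ → ℝ}
    (h : GoodPilot b m n K k₀ σ X E) (hσ : ∀ x ∈ cube d, σ x = σ' x) :
    GoodPilot b m n K k₀ σ' X E := by
  refine ⟨h.mem_cube, h.count, ?_, h.energy⟩
  have := h.noise
  unfold noiseDeviation at this ⊢
  have e : ∀ z, ∑ i ∈ Finset.range m, tri b (X i) z * (E i ^ 2 - σ (X i) ^ 2) =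
      ∑ i ∈ Finset.range m, tri b (X i) z * (E i ^ 2 - σ' (X i) ^ 2) := fun z =>
    Finset.sum_congr rfl fun i hi => by rw [hσ _ (h.mem_cube i (Finset.mem_range.1 hi))]
  simpa only [e] using this

lemma NoiseCondition.lintegral_sq_le {σmax : ℝ} {K : ℝ≥0} {θ₁ θ₂ : ℝ} {σ : Pt d → ℝ}
    [∀ i, IsMarkovKernel (Q i)] (hN : NoiseCondition σmax K θ₁ θ₂ σ Q) (i : ℕ) {x : Pt d}
    (hx : x ∈ cube d) :
    ∫⁻ e, ENNReal.ofReal (e ^ 2) ∂(Q i x) ≤ ENNReal.ofReal (σmax ^ 2) := by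
  have hsq : Integrable (fun e : ℝ => e ^ 2) (Q i x) := by
    simpa using ((hN.subGaussian i x hx).memLp 2).integrable_sq
  rw [← ofReal_integral_eq_lintegral_ofReal hsq (Filter.Eventually.of_forall fun _ => sq_nonneg _)]
  apply ENNReal.ofReal_le_ofReal
  have : ∫ e, e ^ 2 ∂(Q i x) = Var[id; Q i x] := by
    rw [variance_of_integral_eq_zero aemeasurable_id (by simpa using hN.mean_zero i x hx)]
    rfl
  rw [this, hN.variance_eq i x hx]
  exact hN.variance_le x hx

lemma measurable_tri_extend (b : ℝ) (i : ℕ) :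
    Measurable fun p : (Fin k → Pt d × ℝ) × Pt d => tri b (extend p.1 i).1 p.2 := by
  have h1 : Measurable fun p : (Fin k → Pt d × ℝ) × Pt d => (extend p.1 i).1 :=
    measurable_fst.comp ((measurable_extend i).comp measurable_fst)
  unfold tri
  exact measurable_const.max (measurable_const.sub (h1.sub measurable_snd).norm)

lemma measurableSet_noiseDeviation (b : ℝ) (K : ℝ≥0) (a : ℝ) {σ : Pt d → ℝ} (hσ : Measurable σ) :
    MeasurableSet {p : (Fin k → Pt d × ℝ) × Pt d | p.2 ∈ noiseDeviation b m K a σ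
      (fun i => (extend p.1 i).1) (fun i => (extend p.1 i).2)} := by
  have hw := fun i => measurable_tri_extend (k := k) (d := d) b i
  have h1 : ∀ i, Measurable fun p : (Fin k → Pt d × ℝ) × Pt d => (extend p.1 i).1 := fun i =>
    measurable_fst.comp ((measurable_extend i).comp measurable_fst)
  have h2 : ∀ i, Measurable fun p : (Fin k → Pt d × ℝ) × Pt d => (extend p.1 i).2 := fun i =>
    measurable_snd.comp ((measurable_extend i).comp measurable_fst)
  have h3 : ∀ i, Measurable fun p : (Fin k → Pt d × ℝ) × Pt d => σ (extend p.1 i).1 := fun i =>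
    hσ.comp (h1 i)
  refine (measurableSet_le ?_ ?_).union (measurableSet_le ?_ ?_)
  · exact measurable_const.add (measurable_const.mul
      (Finset.measurable_sum _ fun i _ => (hw i).pow_const 2))
  · exact measurable_const.mul
      (measurable_norm.comp (Finset.measurable_sum _ fun i _ => (hw i).mul (h2 i)))
  · exact measurable_const.add (measurable_const.mul
      (Finset.measurable_sum _ fun i _ => (hw i).pow_const 2))
  · exact measurable_const.mul (measurable_norm.comp (Finset.measurable_sum _ fun i _ =>
      (hw i).mul (((h2 i).pow_const 2).sub ((h3 i).pow_const 2))))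

lemma measurableSet_ballCount_lt (r a : ℝ) :
    MeasurableSet {p : (Fin k → Pt d × ℝ) × Pt d |
      ballCount m r (fun i => (extend p.1 i).1) p.2 < a} := by
  classical
  refine measurableSet_lt (Finset.measurable_sum _ fun i _ => Measurable.ite ?_ measurable_const
    measurable_const) measurable_const
  have h1 : Measurable fun p : (Fin k → Pt d × ℝ) × Pt d => (extend p.1 i).1 :=
    measurable_fst.comp ((measurable_extend i).comp measurable_fst)
  exact measurableSet_le (h1.sub measurable_snd).norm measurable_const

variable [∀ i, IsMarkovKernel (Q i)]

lemma pilotLaw_noiseDeviation_le {σmax : ℝ} {K : ℝ≥0} {θ₁ θ₂ : ℝ} {σ : Pt d → ℝ}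
    (hN : NoiseCondition σmax K θ₁ θ₂ σ Q) (hσ : Measurable σ) (hm : m ≤ k) {b : ℝ} (hb : 0 ≤ b)
    (hb1 : b ≤ 1) (z : Pt d) (a : ℝ) :
    pilotLaw k Q {D | z ∈ noiseDeviation b m K a σ
      (fun i => (extend D i).1) (fun i => (extend D i).2)} ≤ 4 * ENNReal.ofReal (Real.exp (-a)) := by
  have hs₀ : (0 : ℝ) ≤ 1 / (8 * (K + 1)) := by positivity
  -- At the largest admissible tilt `1 / (8(K+1))` the variance factor is exactly the `4` built into
  -- `noiseDeviation`.
  have hv : 256 * ((K : ℝ) + 1) ^ 2 * (1 / (8 * (K + 1))) ^ 2 = 4 := by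
    field_simp; norm_num
  have h1 := pilotLaw_weighted_sum_ge_le (Q := Q) hm hb hb1 (ζ := Prod.snd) measurable_snd hs₀
    (v := 256 * (K + 1) ^ 2)
    (fun i x hx s _ => lintegral_exp_mul_le (hN.subGaussian i x hx) s) z a
  have h2 := pilotLaw_weighted_sum_ge_le (Q := Q) hm hb hb1 (ζ := fun p => p.2 ^ 2 - σ p.1 ^ 2)
    (by fun_prop) hs₀ (v := 256 * (K + 1) ^ 2)
    (fun i x hx s hs => by
      have := lintegral_exp_mul_sq_sub_le (hN.subGaussian i x hx) (hN.mean_zero i x hx) hs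
      rwa [hN.variance_eq i x hx] at this) z a
  rw [hv] at h1 h2
  refine (measure_union_le _ _).trans ((add_le_add h1 h2).trans (le_of_eq ?_))
  rw [← add_mul]; norm_num

/-- One term of the exponential series, used to trade an exponentially small probability for any
power of the bandwidth. -/
lemma exp_neg_mul_le {c b : ℝ} (hc : 0 < c) (hb : 0 < b) (j : ℕ) :
    Real.exp (-(c / b ^ 2)) ≤ j.factorial / c ^ j * b ^ (2 * j) := by
  have h := Real.pow_div_factorial_le_exp (c / b ^ 2) (by positivity) j
  rw [Real.exp_neg, inv_le_comm₀ (Real.exp_pos _) (by positivity)]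
  refine le_trans (le_of_eq ?_) h
  rw [div_pow, ← pow_mul]
  field_simp

/-- The constant in the bound for the probability of bad first-step data. -/
def pilotConst (d : ℕ) (c σmax : ℝ) : ℝ :=
  (2 * (d + 2)).factorial / (c / (16 * 4 ^ d)) ^ (2 * (d + 2)) * 4 ^ d + 4 + σmax ^ 2

lemma pilotConst_pos (d : ℕ) {c : ℝ} (hc : 0 < c) (σmax : ℝ) : 0 < pilotConst d c σmax := by
  unfold pilotConst; positivity

/-- Union bound over the four ways to fail, the first of which is null. The order `n⁻³` is what can
later be absorbed in `σ̄² / n`, given that `σ̄` is at least of order `1/n`. -/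
lemma pilotLaw_not_goodPilot_le {σmax : ℝ} {K : ℝ≥0} {θ₁ θ₂ : ℝ} {σ : Pt d → ℝ}
    (hN : NoiseCondition σmax K θ₁ θ₂ σ Q) (hσ : Measurable σ) {b c : ℝ} (hc : 0 < c)
    (hb : 0 < b) (hb1 : b ≤ 1) (hn : 0 < n) (hbn : n * b ^ (d + 2) = 1) (hm : m ≤ k) (hmn : m ≤ n)
    (hcm : c * n / 4 ≤ m) :
    pilotLaw k Q {D | ¬ GoodPilot b m n K (c / (16 * 4 ^ d) / b ^ 2) σ
      (fun i => (extend D i).1) (fun i => (extend D i).2)} ≤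
      ENNReal.ofReal (pilotConst d c σmax / n ^ 3) := by
  have hn0 : (0 : ℝ) < n := by exact_mod_cast hn
  set c₃ := c / (16 * 4 ^ d) with hc₃
  have hc₃0 : 0 < c₃ := by positivity
  set κ : ℝ := (2 * (d + 2)).factorial / c₃ ^ (2 * (d + 2)) * 4 ^ d with hκ
  have hκ0 : 0 ≤ κ := by positivity
  have hsub : {D : Fin k → Pt d × ℝ | ¬ GoodPilot b m n K (c₃ / b ^ 2) σ
      (fun i => (extend D i).1) (fun i => (extend D i).2)} ⊆
      {D | ∃ i, (D i).1 ∉ cube d} ∪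
      ({D | ENNReal.ofReal ((b / 4) ^ d) ≤ uniformCube d {z | (D, z) ∈
        {p : (Fin k → Pt d × ℝ) × Pt d |
          ballCount m (b / 4) (fun i => (extend p.1 i).1) p.2 < c₃ / b ^ 2}}} ∪
      ({D | ENNReal.ofReal (1 / (n : ℝ) ^ 3) ≤ uniformCube d {z | (D, z) ∈
        {p : (Fin k → Pt d × ℝ) × Pt d | p.2 ∈ noiseDeviation b m K (6 * Real.log n) σ
          (fun i => (extend p.1 i).1) (fun i => (extend p.1 i).2)}}} ∪
      {D | (n : ℝ) ^ 4 < ∑ i ∈ Finset.range m, (extend D i).2 ^ 2})) := by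
    intro D hD
    by_contra hcon
    simp only [Set.mem_union, not_or] at hcon
    obtain ⟨h1, h2, h3, h4⟩ := hcon
    refine hD ⟨fun i hi => ?_, not_le.1 h2, not_le.1 h3, not_lt.1 h4⟩
    by_contra hni
    exact h1 ⟨⟨i, by omega⟩, by rwa [← extend_of_lt D (by omega : i < k)]⟩
  have hP1 := pilotLaw_exists_notMem_cube (k := k) (Q := Q)
  have hP2 : pilotLaw k Q {D | ENNReal.ofReal ((b / 4) ^ d) ≤ uniformCube d {z | (D, z) ∈
        {p : (Fin k → Pt d × ℝ) × Pt d |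
          ballCount m (b / 4) (fun i => (extend p.1 i).1) p.2 < c₃ / b ^ 2}}} ≤
      ENNReal.ofReal (κ / n ^ 3) := by
    have h1 := measure_volume_slice_ge_le (pilotLaw k Q)
      (measurableSet_ballCount_lt (k := k) (d := d) (m := m) (b / 4) (c₃ / b ^ 2))
      (η := ENNReal.ofReal ((b / 4) ^ d)) (ε := ENNReal.ofReal (Real.exp (-(c₃ / b ^ 2))))
      (by simp only [ne_eq, ENNReal.ofReal_eq_zero, not_le]; positivity) ENNReal.ofReal_ne_top
      (fun z hz => by
        refine (pilotLaw_ballCount_lt_le hm (by positivity) (by linarith) hz _).trans ?_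
        apply ENNReal.ofReal_le_ofReal
        apply Real.exp_le_exp.2
        -- Here `n b^d = b⁻²`. The constant `c / (16 · 4^d)` makes the exponent twice the threshold,
        -- leaving `exp(-c₃/b²)`.
        have e1 : c * n / 4 * ((b / 4) ^ d / 2) = 2 * (c₃ / b ^ 2) := by
          rw [hc₃, div_pow]
          field_simp
          calc _ = 16 * (n * b ^ (d + 2)) := by ring
            _ = _ := by rw [hbn]; norm_num
        have e2 : c * n / 4 * ((b / 4) ^ d / 2) ≤ m * ((b / 4) ^ d / 2) := by gcongr
        linarith)
    refine h1.trans ?_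
    rw [← ENNReal.ofReal_div_of_pos (by positivity)]
    apply ENNReal.ofReal_le_ofReal
    -- The power `b^(4(d+2))` is below `b^(3(d+2)) · b^d`: the first factor is `n⁻³`, the second
    -- pays for Markov's division by `(b/4)^d`.
    have h2 := exp_neg_mul_le hc₃0 hb (2 * (d + 2))
    have h3 : (1 : ℝ) / n = b ^ (d + 2) := by field_simp; linarith
    rw [div_le_iff₀ (by positivity), div_eq_mul_one_div κ, ← one_div_pow, h3]
    refine h2.trans ?_
    have h4 : b ^ (2 * (2 * (d + 2))) ≤ (b ^ (d + 2)) ^ 3 * b ^ d := by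
      rw [← pow_mul, ← pow_add]
      exact pow_le_pow_of_le_one hb.le hb1 (by omega)
    rw [hκ, show (b / 4) ^ d = b ^ d / 4 ^ d from div_pow _ _ _]
    clear_value c₃
    calc _ ≤ (2 * (d + 2)).factorial / c₃ ^ (2 * (d + 2)) * ((b ^ (d + 2)) ^ 3 * b ^ d) := by
          gcongr
      _ = _ := by field_simp
  -- The level `6 log n` yields `n⁻⁶` pointwise, shared equally between the volume threshold and the
  -- probability.
  have hP3 : pilotLaw k Q {D | ENNReal.ofReal (1 / (n : ℝ) ^ 3) ≤ uniformCube d {z | (D, z) ∈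
        {p : (Fin k → Pt d × ℝ) × Pt d | p.2 ∈ noiseDeviation b m K (6 * Real.log n) σ
          (fun i => (extend p.1 i).1) (fun i => (extend p.1 i).2)}}} ≤
      ENNReal.ofReal (4 / n ^ 3) := by
    have h1 := measure_volume_slice_ge_le (pilotLaw k Q)
      (measurableSet_noiseDeviation (k := k) (m := m) b K (6 * Real.log n) hσ)
      (η := ENNReal.ofReal (1 / (n : ℝ) ^ 3)) (ε := ENNReal.ofReal (4 / n ^ 6))
      (by simp only [ne_eq, ENNReal.ofReal_eq_zero, not_le]; positivity) ENNReal.ofReal_ne_top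
      (fun z _ => by
        refine (pilotLaw_noiseDeviation_le hN hσ hm hb.le hb1 z _).trans (le_of_eq ?_)
        have : Real.exp (-(6 * Real.log n)) = 1 / n ^ 6 := by
          rw [Real.exp_neg, mul_comm, show (6 : ℝ) = (6 : ℕ) by norm_num, Real.exp_mul,
            Real.exp_log hn0, Real.rpow_natCast, one_div]
        rw [this, ← ENNReal.ofReal_ofNat 4, ← ENNReal.ofReal_mul (by norm_num)]
        congr 1
        ring)
    refine h1.trans (le_of_eq ?_)
    rw [← ENNReal.ofReal_div_of_pos (by positivity)]
    congr 1
    field_simp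
  have hP4 : pilotLaw k Q {D | (n : ℝ) ^ 4 < ∑ i ∈ Finset.range m, (extend D i).2 ^ 2} ≤
      ENNReal.ofReal (σmax ^ 2 / n ^ 3) := by
    refine (pilotLaw_energy_gt_le hm (fun i x hx => hN.lintegral_sq_le i hx) (by positivity)).trans ?_
    apply ENNReal.ofReal_le_ofReal
    rw [div_le_div_iff₀ (by positivity) (by positivity)]
    have : (m : ℝ) ≤ n := by exact_mod_cast hmn
    calc m * σmax ^ 2 * (n : ℝ) ^ 3 ≤ n * σmax ^ 2 * (n : ℝ) ^ 3 := by gcongr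
      _ = _ := by ring
  refine (measure_mono hsub).trans ((measure_union_le _ _).trans ?_)
  rw [hP1, zero_add]
  refine (measure_union_le _ _).trans
    ((add_le_add hP2 ((measure_union_le _ _).trans (add_le_add hP3 hP4))).trans (le_of_eq ?_))
  rw [← ENNReal.ofReal_add (by positivity) (by positivity),
    ← ENNReal.ofReal_add (by positivity) (by positivity)]
  congr 1
  rw [pilotConst, ← hc₃, ← hκ]
  ring

end

/-! ### Inverse binomial moments and the count of second-step points. -/

section

/-- The mean of `1/(1 + Bin(N,p))`: absorbing `1/(j+1)` turns `N choose j` into `(N+1) choose (j+1)`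
over `N+1`, and the binomial theorem of order `N+1`, with its zeroth term dropped, bounds the sum.
-/
lemma sum_choose_mul_div_succ_le (N : ℕ) {p : ℝ} (hp : 0 < p) (hp1 : p ≤ 1) :
    ∑ j ∈ Finset.range (N + 1), (N.choose j : ℝ) * (1 / (j + 1) * (p ^ j * (1 - p) ^ (N - j))) ≤
      1 / ((N + 1) * p) := by
  have hq : 0 ≤ 1 - p := by linarith
  have h1 := add_pow p (1 - p) (N + 1)
  rw [add_sub_cancel, one_pow, Finset.sum_range_succ'] at h1
  have h2 : ∀ j ∈ Finset.range (N + 1),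
      (N.choose j : ℝ) * (1 / (j + 1) * (p ^ j * (1 - p) ^ (N - j))) =
      1 / ((N + 1) * p) * (p ^ (j + 1) * (1 - p) ^ (N + 1 - (j + 1)) * ((N + 1).choose (j + 1) : ℕ)) := by
    intro j _
    have h3 : ((N + 1 : ℕ) : ℝ) * N.choose j = (N + 1).choose (j + 1) * (j + 1 : ℕ) := by
      exact_mod_cast Nat.add_one_mul_choose_eq N j
    push_cast at h3
    have h4 : ((N + 1).choose (j + 1) : ℝ) = (N + 1) * N.choose j / (j + 1) := by
      rw [eq_div_iff (by positivity)]; linarith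
    rw [h4, Nat.add_sub_add_right]
    field_simp
    ring
  rw [Finset.sum_congr rfl h2, ← Finset.mul_sum]
  refine mul_le_of_le_one_right (by positivity) ?_
  have h5 : 0 ≤ p ^ 0 * (1 - p) ^ (N + 1 - 0) * ((N + 1).choose 0 : ℝ) := by positivity
  linarith

/-- The expectation of `1 / max 1 N` for a binomial variable `N`, written as a sum over the
patterns of successes. -/
lemma sum_powerset_inv_card_le {ι : Type*} (N : Finset ι) {p : ℝ} (hp : 0 < p) (hp1 : p ≤ 1) :
    ∑ s ∈ N.powerset, 1 / max 1 (s.card : ℝ) * (p ^ s.card * (1 - p) ^ (N.card - s.card)) ≤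
      2 / ((N.card + 1) * p) := by
  have hq : 0 ≤ 1 - p := by linarith
  rw [Finset.sum_powerset_apply_card (fun j => 1 / max 1 (j : ℝ) * (p ^ j * (1 - p) ^ (N.card - j)))]
  simp only [nsmul_eq_mul]
  have h := sum_choose_mul_div_succ_le N.card hp hp1
  calc _ ≤ ∑ j ∈ Finset.range (N.card + 1),
        2 * ((N.card.choose j : ℝ) * (1 / (j + 1) * (p ^ j * (1 - p) ^ (N.card - j)))) := by
        refine Finset.sum_le_sum fun j _ => ?_
        have h1 : 1 / max 1 (j : ℝ) ≤ 2 * (1 / (j + 1)) := by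
          rw [mul_one_div, div_le_div_iff₀ (by positivity) (by positivity)]
          have h2 := le_max_left 1 (j : ℝ)
          have h3 := le_max_right 1 (j : ℝ)
          linarith
        calc _ ≤ (N.card.choose j : ℝ) * (2 * (1 / (j + 1)) * (p ^ j * (1 - p) ^ (N.card - j))) := by
              gcongr
          _ = _ := by ring
    _ ≤ _ := by
        rw [← Finset.mul_sum]
        calc _ ≤ 2 * (1 / ((N.card + 1) * p)) := by gcongr
          _ = _ := by ring

lemma sum_powerset_inv_card_le_one {ι : Type*} (N : Finset ι) {p : ℝ} (hp : 0 ≤ p) (hp1 : p ≤ 1) :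
    ∑ s ∈ N.powerset, 1 / max 1 (s.card : ℝ) * (p ^ s.card * (1 - p) ^ (N.card - s.card)) ≤ 1 := by
  have hq : 0 ≤ 1 - p := by linarith
  have h := Finset.sum_pow_mul_eq_add_pow p (1 - p) N
  rw [add_sub_cancel, one_pow] at h
  refine le_trans (Finset.sum_le_sum fun s _ => ?_) h.le
  have h0 : 0 ≤ p ^ s.card * (1 - p) ^ (N.card - s.card) := by positivity
  refine mul_le_of_le_one_left h0 ?_
  have h1 : (1 : ℝ) ≤ max 1 (s.card : ℝ) := le_max_left _ _
  exact (div_le_one (by positivity)).2 h1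

/-- The lower integral is superadditive without measurability, so the mass of a ball need not be
shown measurable as a function of the first-step data. -/
lemma sum_lintegral_le {α ι : Type*} [MeasurableSpace α] (μ : Measure α) (s : Finset ι)
    (F : ι → α → ℝ≥0∞) : ∑ i ∈ s, ∫⁻ a, F i a ∂μ ≤ ∫⁻ a, ∑ i ∈ s, F i a ∂μ := by
  classical
  induction s using Finset.induction_on with
  | empty => simp
  | insert i s hi ih =>
    simp_rw [Finset.sum_insert hi]
    exact (add_le_add le_rfl ih).trans (le_lintegral_add _ _)

variable {d n : ℕ} {Ω : Type*} [MeasurableSpace Ω] {P : Measure Ω} {c : ℝ} {f : Pt d → ℝ}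
  {Q : ℕ → Kernel (Pt d) ℝ} [∀ i, IsMarkovKernel (Q i)] {x : ℕ → Ω → Pt d} {ε : ℕ → Ω → ℝ}

-- The second-step law is applied with the ball for indices in `s` and its complement for the
-- others, each times all noises; conditionally on Step 1 the hits are thus independent Bernoulli
-- trials.
open Classical in
lemma IsRetrievalSample.measure_pattern (hS : IsRetrievalSample P c n f Q x ε) (z : Pt d) (h : ℝ)
    {s : Finset ℕ} (hs : s ⊆ Finset.Ico (pilotSize c n) n) :
    P {ω | (Finset.Ico (pilotSize c n) n).filter (fun j => ‖x j ω - z‖ ≤ h) = s} =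
      ∫⁻ D, retrievalLaw c n f (fun i => (extend D i).1) (fun i => (extend D i).2)
          {y | ‖y - z‖ ≤ h} ^ s.card *
        retrievalLaw c n f (fun i => (extend D i).1) (fun i => (extend D i).2)
          {y | ‖y - z‖ ≤ h}ᶜ ^ ((Finset.Ico (pilotSize c n) n).card - s.card)
        ∂(P.map (firstData (pilotSize c n) x ε)) := by
  set N := Finset.Ico (pilotSize c n) n with hN
  have hB : MeasurableSet {y : Pt d | ‖y - z‖ ≤ h} := measurableSet_le (by fun_prop) (by fun_prop)
  set B := {y : Pt d | ‖y - z‖ ≤ h} with hBdef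
  have h2 := hS.second_step Set.univ MeasurableSet.univ
    (fun j => (if j ∈ s then B else Bᶜ) ×ˢ Set.univ)
    (fun j => by split_ifs <;> exact MeasurableSet.prod (by measurability) MeasurableSet.univ)
  rw [Measure.restrict_univ] at h2
  refine Eq.trans ?_ (h2.trans (lintegral_congr fun D => ?_))
  · congr 1
    ext ω
    simp only [Set.mem_ofPred_eq, Set.mem_univ, true_and, Set.mem_prod, and_true, ← hN]
    constructor
    · intro he j hj
      rw [← he]
      by_cases hj' : ‖x j ω - z‖ ≤ h
      · rw [if_pos (Finset.mem_filter.2 ⟨hj, hj'⟩)]; exact hj'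
      · rw [if_neg fun hm : j ∈ N.filter (fun j => ‖x j ω - z‖ ≤ h) => hj' (Finset.mem_filter.1 hm).2]; exact hj'
    · intro he
      ext j
      rw [Finset.mem_filter]
      constructor
      · rintro ⟨hj, hj'⟩
        by_contra hjs
        have := he j hj
        rw [if_neg hjs] at this
        exact this hj'
      · intro hjs
        have := he j (hs hjs)
        rw [if_pos hjs] at this
        exact ⟨hs hjs, this⟩
  · set ν := retrievalLaw c n f (fun i => (extend D i).1) (fun i => (extend D i).2)
    have h3 : ∀ j, ∀ A : Set (Pt d), MeasurableSet A → (ν ⊗ₘ Q j) (A ×ˢ Set.univ) = ν A := by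
      intro j A hA
      rw [Set.prod_univ, ← Measure.fst_apply hA, Measure.fst_compProd]
    have h4 : ∀ j ∈ N, (ν ⊗ₘ Q j) ((if j ∈ s then B else Bᶜ) ×ˢ Set.univ) =
        if j ∈ s then ν B else ν Bᶜ := by
      intro j _
      split_ifs
      · exact h3 j B hB
      · exact h3 j _ hB.compl
    rw [Finset.prod_congr rfl h4, Finset.prod_ite, Finset.prod_const, Finset.prod_const,
      Finset.filter_mem_eq_inter, Finset.inter_eq_right.2 hs, Finset.filter_notMem_eq_sdiff,
      Finset.card_sdiff_of_subset hs]

/-- If the retrieval distribution gives mass at least `p` to a ball, except on an event of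
probability at most `η`, then the inverse number of second-step points in the ball is of order
`1 / (N p)` on average. -/
lemma IsRetrievalSample.lintegral_inv_localCount_le (hS : IsRetrievalSample P c n f Q x ε)
    [IsProbabilityMeasure P] (z : Pt d) (h : ℝ) {p : ℝ} (hp : 0 < p) {η : ℝ≥0∞}
    (hη : pilotLaw (pilotSize c n) Q {D | retrievalLaw c n f (fun i => (extend D i).1)
      (fun i => (extend D i).2) {y | ‖y - z‖ ≤ h} < ENNReal.ofReal p} ≤ η) :
    ∫⁻ ω, ENNReal.ofReal (1 / max 1 (localCount (Finset.Ico (pilotSize c n) n)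
        (fun i => x i ω) h z : ℝ)) ∂P ≤
      ENNReal.ofReal (2 / (((Finset.Ico (pilotSize c n) n).card + 1) * p)) + η := by
  classical
  set N := Finset.Ico (pilotSize c n) n with hN
  have hB : MeasurableSet {y : Pt d | ‖y - z‖ ≤ h} := measurableSet_le (by fun_prop) (by fun_prop)
  set B := {y : Pt d | ‖y - z‖ ≤ h} with hBdef
  set ν := fun D : Fin (pilotSize c n) → Pt d × ℝ =>
    retrievalLaw c n f (fun i => (extend D i).1) (fun i => (extend D i).2) with hν
  have hmeas : ∀ s, MeasurableSet {ω | N.filter (fun j => ‖x j ω - z‖ ≤ h) = s} := by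
    intro s
    have e : {ω | N.filter (fun j => ‖x j ω - z‖ ≤ h) = s} =
        ⋂ j, {ω | (j ∈ N ∧ ‖x j ω - z‖ ≤ h) ↔ j ∈ s} := by
      ext ω
      simp [Finset.ext_iff]
    rw [e]
    refine MeasurableSet.iInter fun j => ?_
    by_cases hj : j ∈ N
    · have hx := hS.measurable_x j (Finset.mem_Ico.1 hj).2
      have hm : MeasurableSet {ω | ‖x j ω - z‖ ≤ h} :=
        measurableSet_le (by fun_prop) measurable_const
      by_cases hjs : j ∈ s
      · simpa [hj, hjs] using hm
      · simp only [hj, hjs, true_and, iff_false]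
        exact hm.compl
    · simp [hj]
  -- The count depends only on which indices hit the ball, so its inverse is a finite sum over
  -- patterns.
  have h1 : ∀ ω, ENNReal.ofReal (1 / max 1 (localCount N (fun i => x i ω) h z : ℝ)) =
      ∑ s ∈ N.powerset, {ω | N.filter (fun j => ‖x j ω - z‖ ≤ h) = s}.indicator
        (fun _ => ENNReal.ofReal (1 / max 1 (s.card : ℝ))) ω := by
    intro ω
    rw [Finset.sum_eq_single (N.filter (fun j => ‖x j ω - z‖ ≤ h))]
    · rw [Set.indicator_of_mem (by rfl)]
      rfl
    · intro s _ hs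
      exact Set.indicator_of_notMem (fun hm => hs hm.symm) _
    · intro hs
      exact absurd (Finset.mem_powerset.2 (Finset.filter_subset _ _)) hs
  simp_rw [h1]
  rw [lintegral_finsetSum _ fun s _ => measurable_const.indicator (hmeas s)]
  have h2 : ∀ s ∈ N.powerset, ∫⁻ ω, {ω | N.filter (fun j => ‖x j ω - z‖ ≤ h) = s}.indicator
        (fun _ => ENNReal.ofReal (1 / max 1 (s.card : ℝ))) ω ∂P ≤
      ∫⁻ D, ENNReal.ofReal (1 / max 1 (s.card : ℝ)) *
        (ν D B ^ s.card * ν D Bᶜ ^ (N.card - s.card)) ∂(pilotLaw (pilotSize c n) Q) := by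
    intro s hs
    rw [lintegral_indicator_const (hmeas s), hS.measure_pattern z h (Finset.mem_powerset.1 hs),
      hS.first_step]
    exact lintegral_const_mul_le _ _
  refine (Finset.sum_le_sum h2).trans ((sum_lintegral_le _ _ _).trans ?_)
  have h3 : ∀ D, ∑ s ∈ N.powerset, ENNReal.ofReal (1 / max 1 (s.card : ℝ)) *
        (ν D B ^ s.card * ν D Bᶜ ^ (N.card - s.card)) =
      ENNReal.ofReal (∑ s ∈ N.powerset, 1 / max 1 (s.card : ℝ) *
        ((ν D).real B ^ s.card * (1 - (ν D).real B) ^ (N.card - s.card))) := by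
    intro D
    have hq : 0 ≤ 1 - (ν D).real B := by linarith [measureReal_le_one (μ := ν D) (s := B)]
    rw [ENNReal.ofReal_sum_of_nonneg fun s _ => by positivity]
    refine Finset.sum_congr rfl fun s _ => ?_
    rw [ENNReal.ofReal_mul (by positivity), ENNReal.ofReal_mul (by positivity),
      ENNReal.ofReal_pow (by positivity), ENNReal.ofReal_pow hq, ← probReal_compl_eq_one_sub hB,
      ofReal_measureReal, ofReal_measureReal]
  simp_rw [h3]
  set bad := {D | ν D B < ENNReal.ofReal p} with hbad
  -- The bad event is replaced by a measurable hull of the same measure, since its own measurability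
  -- is not established.
  set M := toMeasurable (pilotLaw (pilotSize c n) Q) bad
  have h4 : ∀ D, ENNReal.ofReal (∑ s ∈ N.powerset, 1 / max 1 (s.card : ℝ) *
        ((ν D).real B ^ s.card * (1 - (ν D).real B) ^ (N.card - s.card))) ≤
      ENNReal.ofReal (2 / ((N.card + 1) * p)) + M.indicator 1 D := by
    intro D
    have hle1 := measureReal_le_one (μ := ν D) (s := B)
    by_cases hD : D ∈ M
    · rw [Set.indicator_of_mem hD]
      refine le_add_left ?_
      rw [Pi.one_apply, ← ENNReal.ofReal_one]
      exact ENNReal.ofReal_le_ofReal (sum_powerset_inv_card_le_one N measureReal_nonneg hle1)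
    · have hD' : ENNReal.ofReal p ≤ ν D B := by
        by_contra hlt
        exact hD (subset_toMeasurable _ _ (not_le.1 hlt))
      have hpB : p ≤ (ν D).real B :=
        (ENNReal.ofReal_le_iff_le_toReal (measure_ne_top _ _)).1 hD'
      refine le_add_right (ENNReal.ofReal_le_ofReal ?_)
      refine (sum_powerset_inv_card_le N (hp.trans_le hpB) hle1).trans ?_
      gcongr
  refine (lintegral_mono h4).trans ?_
  rw [lintegral_add_left measurable_const, lintegral_const, measure_univ, mul_one,
    lintegral_indicator_one (measurableSet_toMeasurable _ _), measure_toMeasurable]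
  gcongr

end

/-! ### From an accurate estimate to a lower bound on the mass of balls. -/

section

variable {d : ℕ}

/-- If `g` approximates `σ` off a small exceptional set, then the normalized law of `g` gives to a
ball around `z` a mass of order `σ z` times its volume. -/
lemma le_normalizedLaw_ball {g σ : Pt d → ℝ} (hg : Continuous g) (hg0 : ∀ x, 0 ≤ g x)
    (hσ : ContinuousOn σ (cube d)) {V : Set (Pt d)} (hV : MeasurableSet V)
    {η α G h : ℝ} (hη : uniformCube d V ≤ ENNReal.ofReal η) (hη0 : 0 ≤ η) (hα : 0 ≤ α)
    (hG0 : 0 ≤ G) (hgσ : ∀ x ∈ cube d, x ∉ V → |g x - σ x| ≤ α) (hσ0 : ∀ x ∈ cube d, 0 ≤ σ x)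
    (hgG : ∀ x ∈ cube d, g x ≤ G) {z : Pt d} (hz : z ∈ cube d) (hh : 0 < h) (hh1 : h ≤ 1)
    (hηh : η ≤ h ^ d / 2) (hσz : 0 < σ z) (hαz : 4 * α ≤ σ z)
    (hball : ∀ x ∈ cube d, ‖x - z‖ ≤ h → 3 / 4 * σ z ≤ σ x) :
    ENNReal.ofReal (σ z * h ^ d / (4 * ((∫ x in cube d, σ x) + α + G * η))) ≤
      normalizedLaw g {x | ‖x - z‖ ≤ h} := by
  have hhd : 0 < h ^ d := by positivity
  set B := {x : Pt d | ‖x - z‖ ≤ h} with hB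
  have hBm : MeasurableSet B := measurableSet_le (by fun_prop) (by fun_prop)
  have hcube : ∀ᵐ x ∂(uniformCube d), x ∈ cube d := ae_restrict_mem measurableSet_cube
  have hgint : Integrable g (uniformCube d) := integrableOn_cube_of_continuousOn hg.continuousOn
  have hσint : Integrable σ (uniformCube d) := integrableOn_cube_of_continuousOn hσ
  set J := ∫ x, g x ∂(uniformCube d) with hJ
  -- The exceptional set is too small to cover more than half of the ball's guaranteed volume.
  have hvol : ENNReal.ofReal (h ^ d / 2) ≤ uniformCube d (B \ V) := by
    have h1 := pow_le_uniformCube_ball hz hh.le hh1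
    have h2 : ENNReal.ofReal (h ^ d / 2) + ENNReal.ofReal (h ^ d / 2) ≤
        uniformCube d (B \ V) + ENNReal.ofReal (h ^ d / 2) := by
      rw [← ENNReal.ofReal_add (by positivity) (by positivity), add_halves]
      refine h1.trans ((measure_mono (t := (B \ V) ∪ V) ?_).trans ((measure_union_le _ _).trans ?_))
      · intro x hx
        by_cases hxV : x ∈ V
        · exact Or.inr hxV
        · exact Or.inl ⟨hx, hxV⟩
      · gcongr
        exact hη.trans (ENNReal.ofReal_le_ofReal hηh)
    exact (ENNReal.add_le_add_iff_right ENNReal.ofReal_ne_top).1 h2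
  have hlow : ∀ x ∈ cube d, x ∈ B \ V → σ z / 2 ≤ g x := by
    intro x hx hxB
    have h1 := (abs_le.1 (hgσ x hx hxB.2)).1
    have h2 := hball x hx hxB.1
    linarith
  -- Positivity rules out the uniform fallback in `normalizedLaw`.
  have hJpos : 0 < J := by
    have h1 : ENNReal.ofReal (σ z / 2) * ENNReal.ofReal (h ^ d / 2) ≤ ENNReal.ofReal J := by
      rw [hJ, ofReal_integral_eq_lintegral_ofReal hgint (Filter.Eventually.of_forall hg0)]
      calc _ ≤ ENNReal.ofReal (σ z / 2) * uniformCube d (B \ V) := by gcongr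
        _ = ∫⁻ _ in B \ V, ENNReal.ofReal (σ z / 2) ∂(uniformCube d) := by simp
        _ ≤ ∫⁻ x in B \ V, ENNReal.ofReal (g x) ∂(uniformCube d) := by
            refine setLIntegral_mono_ae' (hBm.diff hV) ?_
            filter_upwards [hcube] with x hx hxB
            exact ENNReal.ofReal_le_ofReal (hlow x hx hxB)
        _ ≤ _ := setLIntegral_le_lintegral _ _
    have h2 : 0 < ENNReal.ofReal (σ z / 2) * ENNReal.ofReal (h ^ d / 2) :=
      ENNReal.mul_pos (by simp [hσz]) (by simpa using hhd)
    exact ENNReal.ofReal_pos.1 (h2.trans_le h1)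
  -- Compare `g` with `σ + α` off `V` and with the crude bound `G` on `V`.
  have hJle : J ≤ (∫ x in cube d, σ x) + α + G * η := by
    have hVint : Integrable (V.indicator fun _ => G) (uniformCube d) :=
      (integrable_const G).indicator hV
    have h1 : J ≤ ∫ x, (σ x + α + V.indicator (fun _ => G) x) ∂(uniformCube d) := by
      refine integral_mono_ae hgint ((hσint.add (integrable_const α)).add hVint) ?_
      filter_upwards [hcube] with x hx
      by_cases hxV : x ∈ V
      · rw [Set.indicator_of_mem hxV]
        have := hgG x hx
        have := hσ0 x hx
        linarith
      · rw [Set.indicator_of_notMem hxV]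
        have := (abs_le.1 (hgσ x hx hxV)).2
        linarith
    have h0 : Integrable (fun x => σ x + α) (uniformCube d) := hσint.add (integrable_const α)
    rw [integral_add h0 hVint, integral_add hσint (integrable_const α),
      integral_indicator_const _ hV, integral_const, probReal_univ, one_smul, smul_eq_mul] at h1
    have h2 : (uniformCube d).real V ≤ η := ENNReal.toReal_le_of_le_ofReal hη0 hη
    have h3 : (uniformCube d).real V * G ≤ G * η := by rw [mul_comm]; gcongr
    exact h1.trans (add_le_add_right h3 _)
  have hJ' : ¬ (∫ x in cube d, g x = 0) := hJpos.ne'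
  rw [normalizedLaw, if_neg hJ', withDensity_apply _ hBm]
  calc _ ≤ ENNReal.ofReal (σ z / 2 / J * (h ^ d / 2)) := by
        apply ENNReal.ofReal_le_ofReal
        rw [show σ z / 2 / J * (h ^ d / 2) = σ z * h ^ d / (4 * J) by field_simp; ring]
        gcongr
    _ = ENNReal.ofReal (σ z / 2 / J) * ENNReal.ofReal (h ^ d / 2) :=
        ENNReal.ofReal_mul (by positivity)
    _ ≤ ENNReal.ofReal (σ z / 2 / J) * uniformCube d (B \ V) := by gcongr
    _ = ∫⁻ _ in B \ V, ENNReal.ofReal (σ z / 2 / J) ∂(uniformCube d) := by simp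
    _ ≤ ∫⁻ x in B \ V, ENNReal.ofReal (g x / J) ∂(uniformCube d) := by
        refine setLIntegral_mono_ae' (hBm.diff hV) ?_
        filter_upwards [hcube] with x hx hxB
        exact ENNReal.ofReal_le_ofReal (div_le_div_of_nonneg_right (hlow x hx hxB) hJpos.le)
    _ ≤ ∫⁻ x in B, ENNReal.ofReal (g x / J) ∂(uniformCube d) :=
        lintegral_mono_set Set.sdiff_subset

variable {m n : ℕ} {b k₀ : ℝ} {K : ℝ≥0} {σ : Pt d → ℝ} {X : ℕ → Pt d} {E : ℕ → ℝ}

/-- The badly covered centres have less volume than a ball of radius `b/4` in the cube, so each such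
ball contains a well covered centre. Covariates within `b/4` of it lie within `b/2` of `x` and have
weight at least `b/2`. A volume bound thus becomes a bound at every point. -/
lemma GoodPilot.le_sum_tri (hgood : GoodPilot b m n K k₀ σ X E) (hb : 0 ≤ b) (hb1 : b ≤ 1)
    {x : Pt d} (hx : x ∈ cube d) : b / 2 * k₀ ≤ ∑ i ∈ Finset.range m, tri b (X i) x := by
  classical
  have h1 := pow_le_uniformCube_ball hx (r := b / 4) (by positivity) (by linarith)
  obtain ⟨z, hz1, hz2⟩ : ∃ z, ‖z - x‖ ≤ b / 4 ∧ k₀ ≤ ballCount m (b / 4) X z := by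
    by_contra hcon
    push Not at hcon
    have : {y : Pt d | ‖y - x‖ ≤ b / 4} ⊆ {z | ballCount m (b / 4) X z < k₀} :=
      fun z hz => hcon z hz
    exact absurd (h1.trans (measure_mono this)) (not_le.2 hgood.count)
  calc b / 2 * k₀ ≤ b / 2 * ballCount m (b / 4) X z := by gcongr
    _ ≤ _ := by
      rw [ballCount, Finset.mul_sum]
      refine Finset.sum_le_sum fun i _ => ?_
      split_ifs with hi
      · have : ‖X i - x‖ ≤ ‖X i - z‖ + ‖z - x‖ := norm_sub_le_norm_sub_add_norm_sub _ _ _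
        refine le_trans ?_ (le_max_right _ _)
        linarith
      · simpa using tri_nonneg _ _ _

/-- For fixed data `σ` enters only through the constants `σ (X i)`, so the set is cut out by
continuous functions of the point whatever `σ` is. -/
lemma isClosed_noiseDeviation (a : ℝ) : IsClosed (noiseDeviation b m K a σ X E) := by
  have htri : ∀ i, Continuous fun x => tri b (X i) x := fun i =>
    (continuous_tri b).comp (continuous_const.prodMk continuous_id)
  refine (isClosed_le (by fun_prop) ?_).union (isClosed_le (by fun_prop) ?_)
  all_goals fun_prop

/-- The relative size of the noise averages off the deviation set. -/
lemma abs_sum_le_of_notMem_noiseDeviation {a c₃ : ℝ} {x : Pt d} (ha : 0 ≤ a) (hb : 0 < b)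
    (hc₃ : 0 < c₃) (hS : c₃ / (2 * b) ≤ ∑ i ∈ Finset.range m, tri b (X i) x)
    (hx : x ∉ noiseDeviation b m K a σ X E) :
    |∑ i ∈ Finset.range m, tri b (X i) x * E i| ≤
      8 * (K + 1) * (2 * a / c₃ + 4) * b * ∑ i ∈ Finset.range m, tri b (X i) x ∧
    |∑ i ∈ Finset.range m, tri b (X i) x * (E i ^ 2 - σ (X i) ^ 2)| ≤
      8 * (K + 1) * (2 * a / c₃ + 4) * b * ∑ i ∈ Finset.range m, tri b (X i) x := by
  set S := ∑ i ∈ Finset.range m, tri b (X i) x with hSdef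
  have h1 : ∑ i ∈ Finset.range m, tri b (X i) x ^ 2 ≤ b * S := by
    rw [hSdef, Finset.mul_sum]
    refine Finset.sum_le_sum fun i _ => ?_
    rw [sq]
    exact mul_le_mul_of_nonneg_right (tri_le hb.le _ _) (tri_nonneg _ _ _)
  -- The additive level `a` becomes a relative error of order `a b`, because the total weight is at
  -- least of order `1/b`.
  have h2 : a ≤ 2 * a / c₃ * b * S := by
    have : 2 * a / c₃ * b * (c₃ / (2 * b)) = a := by field_simp
    calc a = 2 * a / c₃ * b * (c₃ / (2 * b)) := this.symm
      _ ≤ _ := by gcongr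
  have key : ∀ u : ℝ, ¬ (a + 4 * ∑ i ∈ Finset.range m, tri b (X i) x ^ 2 ≤
      1 / (8 * (K + 1)) * |u|) → |u| ≤ 8 * (K + 1) * (2 * a / c₃ + 4) * b * S := by
    intro u hu
    have h3 := not_le.1 hu
    have hK : (0 : ℝ) < 8 * (K + 1) := by positivity
    rw [one_div, inv_mul_lt_iff₀ hK] at h3
    refine h3.le.trans ?_
    calc 8 * ((K : ℝ) + 1) * (a + 4 * ∑ i ∈ Finset.range m, tri b (X i) x ^ 2) ≤
          8 * (K + 1) * (2 * a / c₃ * b * S + 4 * (b * S)) := by gcongr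
      _ = _ := by ring
  exact ⟨key _ fun h => hx (Or.inl h), key _ fun h => hx (Or.inr h)⟩

end

/-! ### The accuracy rate and the retrieval law for good data. -/

section

/-- The constant in the accuracy of the estimated standard deviation. -/
def accuracyConst (d : ℕ) (σmax L τ θ₂ T : ℝ) : ℝ :=
  2 * (L * Real.sqrt d ^ τ) + Real.sqrt (2 * T + 8 * (σmax * L * Real.sqrt d ^ θ₂) + T ^ 2)

lemma accuracyConst_nonneg (d : ℕ) {σmax L τ θ₂ T : ℝ} (hL : 0 ≤ L) :
    0 ≤ accuracyConst d σmax L τ θ₂ T := by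
  unfold accuracyConst; positivity

/-- Put `R = b^(β/2)`, with `β` the minimum in the exponent. The bias `b^τ` is at most `R`; inside
the root, `b^θ₂` and `b` are at most `R²`. Factors `2ℓ` and `4ℓ²`, at least one since `ℓ ≥ 1/2`,
supply the missing logarithms. -/
lemma accuracy_le {d : ℕ} {σmax L τ θ₂ T b ℓ t : ℝ} (hσmax : 0 ≤ σmax) (hL : 0 ≤ L)
    (hT : 0 ≤ T) (hb : 0 < b) (hb1 : b ≤ 1) (hℓ : 1 / 2 ≤ ℓ) (ht : 0 ≤ t) (htT : t ≤ T * b * ℓ) :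
    L * (Real.sqrt d * b) ^ τ +
        Real.sqrt (t + 2 * σmax * (L * (Real.sqrt d * b) ^ θ₂) + t ^ 2) ≤
      accuracyConst d σmax L τ θ₂ T * (ℓ * b ^ (min (2 * τ) (min θ₂ (1 / 2)) / 2)) := by
  set β := min (2 * τ) (min θ₂ (1 / 2)) with hβ
  have hβτ : β / 2 ≤ τ := by have := min_le_left (2 * τ) (min θ₂ (1 / 2)); linarith
  have hβθ : β ≤ θ₂ := (min_le_right _ _).trans (min_le_left _ _)
  have hβ1 : β ≤ 1 := (min_le_right _ _).trans ((min_le_right _ _).trans (by norm_num))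
  set R := b ^ (β / 2) with hR
  have hR0 : 0 < R := Real.rpow_pos_of_pos hb _
  have hR2 : b ^ β = R ^ 2 := by
    rw [hR, ← Real.rpow_natCast, ← Real.rpow_mul hb.le]; norm_num
  have h1 : b ^ τ ≤ R := Real.rpow_le_rpow_of_exponent_ge hb hb1 hβτ
  have h2 : b ^ θ₂ ≤ R ^ 2 := hR2 ▸ Real.rpow_le_rpow_of_exponent_ge hb hb1 hβθ
  have h3 : b ≤ R ^ 2 := by
    have := Real.rpow_le_rpow_of_exponent_ge hb hb1 hβ1
    rwa [Real.rpow_one, hR2] at this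
  have hℓ0 : 0 ≤ ℓ := by linarith
  have hℓ2 : 1 ≤ 4 * ℓ ^ 2 := by nlinarith
  have hℓ3 : ℓ ≤ 2 * ℓ ^ 2 := by nlinarith
  have hd0 : 0 ≤ Real.sqrt d := Real.sqrt_nonneg _
  have e1 : L * (Real.sqrt d * b) ^ τ ≤ 2 * (L * Real.sqrt d ^ τ) * (ℓ * R) := by
    rw [Real.mul_rpow hd0 hb.le]
    have h0 : 0 ≤ L * Real.sqrt d ^ τ := by positivity
    calc L * (Real.sqrt d ^ τ * b ^ τ) = (L * Real.sqrt d ^ τ) * b ^ τ := by ring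
      _ ≤ (L * Real.sqrt d ^ τ) * R := by gcongr
      _ ≤ (L * Real.sqrt d ^ τ) * ((2 * ℓ) * R) := by
          have : 1 * R ≤ (2 * ℓ) * R := by gcongr; linarith
          gcongr
          linarith
      _ = _ := by ring
  have hρ0 : 0 ≤ ℓ * R := by positivity
  have e2 : t + 2 * σmax * (L * (Real.sqrt d * b) ^ θ₂) + t ^ 2 ≤
      (2 * T + 8 * (σmax * L * Real.sqrt d ^ θ₂) + T ^ 2) * (ℓ * R) ^ 2 := by
    have i1 : t ≤ 2 * T * (ℓ * R) ^ 2 := by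
      calc t ≤ T * b * ℓ := htT
        _ ≤ T * R ^ 2 * (2 * ℓ ^ 2) := by gcongr
        _ = _ := by ring
    have i2 : 2 * σmax * (L * (Real.sqrt d * b) ^ θ₂) ≤
        8 * (σmax * L * Real.sqrt d ^ θ₂) * (ℓ * R) ^ 2 := by
      rw [Real.mul_rpow hd0 hb.le]
      have h0 : 0 ≤ σmax * L * Real.sqrt d ^ θ₂ := by positivity
      calc 2 * σmax * (L * (Real.sqrt d ^ θ₂ * b ^ θ₂)) =
            2 * (σmax * L * Real.sqrt d ^ θ₂) * (1 * b ^ θ₂) := by ring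
        _ ≤ 2 * (σmax * L * Real.sqrt d ^ θ₂) * (4 * ℓ ^ 2 * R ^ 2) := by gcongr
        _ = _ := by ring
    have i3 : t ^ 2 ≤ T ^ 2 * (ℓ * R) ^ 2 := by
      calc t ^ 2 ≤ (T * b * ℓ) ^ 2 := by gcongr
        _ = T ^ 2 * (b * b) * ℓ ^ 2 := by ring
        _ ≤ T ^ 2 * (R ^ 2 * 1) * ℓ ^ 2 := by gcongr
        _ = _ := by ring
    calc _ ≤ _ := add_le_add (add_le_add i1 i2) i3
      _ = _ := by ring
  have e3 := Real.sqrt_le_sqrt e2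
  rw [Real.sqrt_mul (by positivity), Real.sqrt_sq hρ0] at e3
  rw [accuracyConst, add_mul]
  exact add_le_add e1 e3

variable {d m n : ℕ} {b c₃ : ℝ} {K : ℝ≥0} {f σ : Pt d → ℝ} {X : ℕ → Pt d} {E : ℕ → ℝ}

/-- For good first-step data, the retrieval density is bounded below near points of high noise. -/
lemma GoodPilot.le_normalizedLaw_sdEst_ball (hgood : GoodPilot b m n K (c₃ / b ^ 2) σ X E)
    {σmax L τ τ₁ θ₁ θ₂ h : ℝ} (hσmax : 0 < σmax) (hL : 0 ≤ L) (hτ : 0 < τ) (hθ₂ : 0 < θ₂)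
    (hτ₁ : 0 ≤ τ₁) (hτ₁L : τ₁ ≤ L) (hθ₁ : 0 ≤ θ₁) (hθ₁L : θ₁ ≤ L)
    (hf : f ∈ HolderClass τ₁ τ (cube d)) (hσ : σ ∈ HolderClass θ₁ θ₂ (cube d))
    (hσ0 : ∀ x ∈ cube d, 0 ≤ σ x) (hσm : ∀ x ∈ cube d, σ x ≤ σmax)
    (hn : 2 ≤ n) (hb : 0 < b) (hb1 : b ≤ 1) (hc₃ : 0 < c₃) (hbc : 2 * b ≤ c₃)
    (hh : 0 < h) (hh1 : h ≤ 1) (hnh : 1 / 2 ≤ n * h ^ d) {z : Pt d} (hz : z ∈ cube d)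
    (hσz : 0 < σ z)
    (hzα : 4 * (accuracyConst d σmax L τ θ₂ (8 * (K + 1) * (12 / c₃ + 8)) *
      (Real.log n * b ^ (min (2 * τ) (min θ₂ (1 / 2)) / 2))) ≤ σ z)
    (hzh : 4 * (θ₁ * (Real.sqrt d * h) ^ θ₂) ≤ σ z) :
    ENNReal.ofReal (σ z * h ^ d / (4 * ((∫ x in cube d, σ x) +
      accuracyConst d σmax L τ θ₂ (8 * (K + 1) * (12 / c₃ + 8)) *
      (Real.log n * b ^ (min (2 * τ) (min θ₂ (1 / 2)) / 2)) +
      (L * Real.sqrt d ^ τ + 1) / n))) ≤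
      normalizedLaw (sdEst b m X (fun i => f (X i) + E i)) {x | ‖x - z‖ ≤ h} := by
  have hn2 : (2 : ℝ) ≤ n := by exact_mod_cast hn
  have hn0 : (0 : ℝ) < n := by linarith
  have hℓ : 1 / 2 ≤ Real.log n :=
    (by linarith [Real.log_two_gt_d9] : 1 / 2 ≤ Real.log 2).trans
      (Real.log_le_log (by norm_num) hn2)
  set T : ℝ := 8 * (K + 1) * (12 / c₃ + 8) with hT
  set α := accuracyConst d σmax L τ θ₂ T *
      (Real.log n * b ^ (min (2 * τ) (min θ₂ (1 / 2)) / 2)) with hα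
  have hα0 : 0 ≤ α := mul_nonneg (accuracyConst_nonneg d hL)
    (mul_nonneg (by linarith) (Real.rpow_nonneg hb.le _))
  have hS : ∀ x ∈ cube d, c₃ / (2 * b) ≤ ∑ i ∈ Finset.range m, tri b (X i) x := fun x hx => by
    refine le_trans (le_of_eq ?_) (hgood.le_sum_tri hb.le hb1 hx)
    field_simp
  have hS1 : ∀ x ∈ cube d, 1 ≤ ∑ i ∈ Finset.range m, tri b (X i) x := fun x hx =>
    ((one_le_div (by positivity)).2 hbc).trans (hS x hx)
  have hfδ : ∀ x ∈ cube d, ∀ i < m, ‖X i - x‖ ≤ b →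
      |f (X i) - f x| ≤ L * (Real.sqrt d * b) ^ τ := fun x hx i hi hxi =>
    HolderClass.abs_sub_le hf hτ₁ hτ₁L hτ.le (hgood.mem_cube i hi) hx hxi
  have hσδ : ∀ x ∈ cube d, ∀ i < m, ‖X i - x‖ ≤ b →
      |σ (X i) ^ 2 - σ x ^ 2| ≤ 2 * σmax * (L * (Real.sqrt d * b) ^ θ₂) := fun x hx i hi hxi => by
    have hXi := hgood.mem_cube i hi
    have h1 := HolderClass.abs_sub_le hσ hθ₁ hθ₁L hθ₂.le hXi hx hxi
    have h2 : |σ (X i) + σ x| ≤ 2 * σmax := by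
      rw [abs_of_nonneg (add_nonneg (hσ0 _ hXi) (hσ0 _ hx))]
      linarith [hσm _ hXi, hσm _ hx]
    rw [sq_sub_sq, abs_mul]
    gcongr
  have hδ0 : 0 ≤ L * (Real.sqrt d * b) ^ τ := by positivity
  have hacc : ∀ x ∈ cube d, x ∉ noiseDeviation b m K (6 * Real.log n) σ X E →
      |sdEst b m X (fun i => f (X i) + E i) x - σ x| ≤ α := by
    intro x hx hxV
    obtain ⟨h1, h2⟩ := abs_sum_le_of_notMem_noiseDeviation (by linarith) hb hc₃ (hS x hx) hxV
    refine (abs_sdEst_sub_le hδ0 (hσ0 x hx) (hS1 x hx) (hfδ x hx) (hσδ x hx) h1 h2).trans ?_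
    refine accuracy_le hσmax.le hL (by positivity) hb hb1 hℓ (by positivity) ?_
    -- The noise level is `6 log n`, and `4 ≤ 8 log n` because `log n ≥ 1/2`; this is the origin of
    -- `12 / c₃ + 8`.
    have h3 : 2 * (6 * Real.log n) / c₃ + 4 ≤ (12 / c₃ + 8) * Real.log n := by
      rw [add_mul, div_mul_eq_mul_div]
      have : 2 * (6 * Real.log n) / c₃ = 12 * Real.log n / c₃ := by ring
      linarith
    calc _ ≤ 8 * (K + 1) * ((12 / c₃ + 8) * Real.log n) * b := by gcongr
      _ = _ := by rw [hT]; ring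
  -- The energy bound `n⁴` gives a supremum of order `n²`; times the volume `n⁻³` of the exceptional
  -- set this is of order `1/n`.
  have hcrude : ∀ x ∈ cube d,
      sdEst b m X (fun i => f (X i) + E i) x ≤ L * Real.sqrt d ^ τ + (n : ℝ) ^ 2 := by
    intro x hx
    refine (sdEst_le hδ0 (hS1 x hx) (hfδ x hx)).trans (add_le_add ?_ ?_)
    · have : (Real.sqrt d * b) ^ τ ≤ Real.sqrt d ^ τ :=
        Real.rpow_le_rpow (by positivity) (mul_le_of_le_one_right (Real.sqrt_nonneg _) hb1) hτ.le
      gcongr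
    · rw [Real.sqrt_le_iff]
      refine ⟨by positivity, hgood.energy.trans (le_of_eq (by ring))⟩
  have hη : uniformCube d (noiseDeviation b m K (6 * Real.log n) σ X E) ≤
      ENNReal.ofReal (1 / (n : ℝ) ^ 3) := hgood.noise.le
  have key := le_normalizedLaw_ball (continuous_sdEst b m X fun i => f (X i) + E i)
    (fun x => Real.sqrt_nonneg _) (HolderClass.continuousOn hσ hθ₁ hθ₂)
    (isClosed_noiseDeviation _).measurableSet hη (by positivity) hα0 (by positivity) hacc hσ0 hcrude
    hz hh hh1 ?_ hσz hzα ?_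
  · refine le_trans (ENNReal.ofReal_le_ofReal ?_) key
    have hint : 0 ≤ ∫ x in cube d, σ x := setIntegral_nonneg measurableSet_cube hσ0
    have h1 : (L * Real.sqrt d ^ τ + (n : ℝ) ^ 2) * (1 / (n : ℝ) ^ 3) ≤
        (L * Real.sqrt d ^ τ + 1) / n := by
      rw [mul_one_div, div_le_div_iff₀ (by positivity) hn0]
      have h0 : 0 ≤ L * Real.sqrt d ^ τ := by positivity
      have : (1 : ℝ) ≤ n ^ 2 := one_le_pow₀ (by linarith)
      nlinarith [mul_nonneg h0 hn0.le, mul_nonneg (mul_nonneg h0 hn0.le) (sub_nonneg.2 this)]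
    gcongr
  · rw [div_le_div_iff₀ (by positivity) (by norm_num)]
    have : (4 : ℝ) ≤ n ^ 2 := by nlinarith
    calc (1 : ℝ) * 2 ≤ (1 / 2) * n ^ 2 := by linarith
      _ ≤ (n * h ^ d) * n ^ 2 := by gcongr
      _ = _ := by ring
  · intro x hx hxz
    have h1 := HolderClass.abs_sub_le hσ hθ₁ le_rfl hθ₂.le hx hz hxz
    have := (abs_le.1 h1).1
    linarith

end

/-! ### Bandwidth arithmetic and integration of the variance term. -/

section

variable {d n : ℕ}

lemma sdBandwidth_pos (hn : 0 < n) : 0 < sdBandwidth d n :=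
  Real.rpow_pos_of_pos (by exact_mod_cast hn) _

lemma sdBandwidth_le_one (hn : 0 < n) : sdBandwidth d n ≤ 1 :=
  Real.rpow_le_one_of_one_le_of_nonpos (by exact_mod_cast hn) (neg_nonpos.2 (by positivity))

lemma mul_sdBandwidth_pow (hn : 0 < n) : n * sdBandwidth d n ^ (d + 2) = 1 := by
  have hn0 : (0 : ℝ) < n := by exact_mod_cast hn
  rw [sdBandwidth, ← Real.rpow_natCast, ← Real.rpow_mul hn0.le]
  push_cast
  rw [show -(1 / ((d : ℝ) + 2)) * (d + 2) = -1 by field_simp, Real.rpow_neg_one]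
  field_simp

lemma rpow_rate_eq (hn : 0 < n) (β : ℝ) :
    (n : ℝ) ^ (-(β / (4 + 2 * (d : ℝ)))) = sdBandwidth d n ^ (β / 2) := by
  have hn0 : (0 : ℝ) < n := by exact_mod_cast hn
  rw [sdBandwidth, ← Real.rpow_mul hn0.le]
  congr 1
  field_simp
  ring

lemma half_le_log (hn : 2 ≤ n) : 1 / 2 ≤ Real.log n :=
  (by linarith [Real.log_two_gt_d9] : 1 / 2 ≤ Real.log 2).trans
    (Real.log_le_log (by norm_num) (by exact_mod_cast hn))

/-- The cap `1/2` keeps the exponent above `-1`. Hence `r̃_n`, and through it `σ̄`, is at least of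
order `1/n`, which lets the polynomially small remainders be absorbed. -/
lemma one_div_le_log_mul_rpow (hn : 2 ≤ n) {τ θ₂ : ℝ} :
    1 / (2 * (n : ℝ)) ≤ Real.log n *
      (n : ℝ) ^ (-(min (2 * τ) (min θ₂ (1 / 2)) / (4 + 2 * (d : ℝ)))) := by
  have hn1 : (1 : ℝ) ≤ n := by exact_mod_cast (by omega : 1 ≤ n)
  have h1 : (n : ℝ) ^ (-1 : ℝ) ≤
      (n : ℝ) ^ (-(min (2 * τ) (min θ₂ (1 / 2)) / (4 + 2 * (d : ℝ)))) := by
    apply Real.rpow_le_rpow_of_exponent_le hn1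
    rw [neg_le_neg_iff, div_le_one (by positivity)]
    have h2 : min (2 * τ) (min θ₂ (1 / 2)) ≤ 1 / 2 := (min_le_right _ _).trans (min_le_right _ _)
    have h3 : (0 : ℝ) ≤ d := by positivity
    linarith
  rw [Real.rpow_neg_one] at h1
  calc 1 / (2 * (n : ℝ)) = 1 / 2 * (n : ℝ)⁻¹ := by rw [one_div, mul_inv, one_div]
    _ ≤ _ := by
      have := half_le_log hn
      gcongr

/-- Discarding points can only increase the term, so the bound for the Step 2 count implies the one
for the full count. -/
lemma varianceTerm_anti {Ω : Type*} [MeasurableSpace Ω] (P : Measure Ω) (x : ℕ → Ω → Pt d)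
    {N N' : Finset ℕ} (hN : N ⊆ N') (σ : Pt d → ℝ) {σmax θ₁ θ₂ h : ℝ} (hσmax : 0 ≤ σmax)
    (hθ₁ : 0 ≤ θ₁) (hh : 0 ≤ h) :
    varianceTerm P x N' σ σmax θ₁ θ₂ h ≤ varianceTerm P x N σ σmax θ₁ θ₂ h := by
  refine lintegral_mono fun z => lintegral_mono fun ω => ENNReal.ofReal_le_ofReal ?_
  have hc : localCount N (fun i => x i ω) h z ≤ localCount N' (fun i => x i ω) h z :=
    Finset.card_le_card (Finset.filter_subset_filter _ hN)
  gcongr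

lemma measurableSet_lowNoise {σ : Pt d → ℝ} (hσ : ContinuousOn σ (cube d)) (t : ℝ) :
    MeasurableSet (lowNoise σ t) :=
  (hσ.preimage_isClosed_of_isClosed isClosed_Icc (isClosed_Iic (a := t))).measurableSet

/-- The average noise level is bounded below in terms of the volume of the low-noise region. -/
lemma le_avgSd_of_volume_lowNoise_le {σ : Pt d → ℝ} (hσ : ContinuousOn σ (cube d))
    (hσ0 : ∀ x ∈ cube d, 0 ≤ σ x) {t c₁ : ℝ} (ht : 0 ≤ t)
    (h : volume.real (lowNoise σ t) ≤ c₁) : (1 - c₁) * t ≤ avgSd σ := by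
  have hm := measurableSet_lowNoise hσ t
  have hint : Integrable ((lowNoise σ t)ᶜ.indicator fun _ => t) (uniformCube d) :=
    (integrable_const t).indicator hm.compl
  have h1 : ∫ x, (lowNoise σ t)ᶜ.indicator (fun _ => t) x ∂(uniformCube d) ≤
      ∫ x in cube d, σ x := by
    refine integral_mono_ae hint (integrableOn_cube_of_continuousOn hσ) ?_
    filter_upwards [ae_restrict_mem measurableSet_cube] with x hx
    by_cases hxt : x ∈ lowNoise σ t
    · rw [Set.indicator_of_notMem (by simpa using hxt)]
      exact hσ0 x hx
    · rw [Set.indicator_of_mem (by simpa using hxt)]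
      by_contra hlt
      exact hxt ⟨hx, (not_le.1 hlt).le⟩
  rw [integral_indicator_const _ hm.compl, probReal_compl_eq_one_sub hm, smul_eq_mul] at h1
  have h2 : (uniformCube d).real (lowNoise σ t) = volume.real (lowNoise σ t) := by
    rw [uniformCube, measureReal_restrict_apply hm,
      Set.inter_eq_left.2 (show lowNoise σ t ⊆ cube d from fun x hx => hx.1)]
  rw [h2] at h1
  rw [avgSd_eq]
  refine le_trans ?_ h1
  gcongr

/-- The trivial bound for the variance term. -/
lemma varianceTerm_le_of_le {Ω : Type*} [MeasurableSpace Ω] (P : Measure Ω) [IsProbabilityMeasure P]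
    (x : ℕ → Ω → Pt d) (N : Finset ℕ) {σ : Pt d → ℝ} {σmax θ₁ θ₂ h A : ℝ}
    (hA : ∀ z ∈ cube d, σ z ^ 2 + σmax * θ₁ * h ^ θ₂ ≤ A) (hA0 : 0 ≤ A) :
    varianceTerm P x N σ σmax θ₁ θ₂ h ≤ ENNReal.ofReal A := by
  calc varianceTerm P x N σ σmax θ₁ θ₂ h
      ≤ ∫⁻ _z in cube d, ENNReal.ofReal A := by
        refine setLIntegral_mono' measurableSet_cube fun z hz => ?_
        calc _ ≤ ∫⁻ _ω, ENNReal.ofReal A ∂P := lintegral_mono fun ω => by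
              apply ENNReal.ofReal_le_ofReal
              have h1 : 1 ≤ max 1 (localCount N (fun i => x i ω) h z : ℝ) := le_max_left _ _
              rw [div_le_iff₀ (by positivity)]
              exact (hA z hz).trans (le_mul_of_one_le_right hA0 h1)
          _ = ENNReal.ofReal A := by simp
    _ = ENNReal.ofReal A := by simp [volume_cube]

/-- Integration of a pointwise bound that distinguishes the low-noise region. -/
lemma varianceTerm_le_of_lowNoise {Ω : Type*} [MeasurableSpace Ω] (P : Measure Ω)
    [IsProbabilityMeasure P]
    (x : ℕ → Ω → Pt d) (N : Finset ℕ) {σ : Pt d → ℝ} (hσ : ContinuousOn σ (cube d))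
    (hσ0 : ∀ x ∈ cube d, 0 ≤ σ x) {σmax θ₁ θ₂ h t A B η W : ℝ} (hA0 : 0 ≤ A) (hB0 : 0 ≤ B)
    (hη0 : 0 ≤ η) (hA : ∀ z ∈ lowNoise σ t, σ z ^ 2 + σmax * θ₁ * h ^ θ₂ ≤ A)
    (hW : ∀ z ∈ cube d, t < σ z → 0 ≤ σ z ^ 2 + σmax * θ₁ * h ^ θ₂ ∧
      ENNReal.ofReal (σ z ^ 2 + σmax * θ₁ * h ^ θ₂) *
      ∫⁻ ω, ENNReal.ofReal (1 / max 1 (localCount N (fun i => x i ω) h z : ℝ)) ∂P ≤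
      ENNReal.ofReal (B * σ z) + ENNReal.ofReal η)
    (hV : A * volume.real (lowNoise σ t) + η + B * avgSd σ ≤ W) :
    varianceTerm P x N σ σmax θ₁ θ₂ h ≤ ENNReal.ofReal W := by
  have hm := measurableSet_lowNoise hσ t
  have hsub : lowNoise σ t ⊆ cube d := fun x hx => hx.1
  calc varianceTerm P x N σ σmax θ₁ θ₂ h
      ≤ ∫⁻ z in cube d, ((lowNoise σ t).indicator (fun _ => ENNReal.ofReal A) z +
          (ENNReal.ofReal η + ENNReal.ofReal (B * σ z))) := by
        refine setLIntegral_mono' measurableSet_cube fun z hz => ?_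
        by_cases hzt : z ∈ lowNoise σ t
        · rw [Set.indicator_of_mem hzt]
          refine le_add_right ?_
          calc _ ≤ ∫⁻ _ω, ENNReal.ofReal A ∂P := lintegral_mono fun ω => by
                apply ENNReal.ofReal_le_ofReal
                have h1 : 1 ≤ max 1 (localCount N (fun i => x i ω) h z : ℝ) := le_max_left _ _
                rw [div_le_iff₀ (by positivity)]
                exact (hA z hzt).trans (le_mul_of_one_le_right hA0 h1)
            _ = ENNReal.ofReal A := by simp
        · rw [Set.indicator_of_notMem hzt, zero_add]
          have hlt : t < σ z := by
            by_contra hle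
            exact hzt ⟨hz, not_lt.1 hle⟩
          obtain ⟨h0, h1⟩ := hW z hz hlt
          refine le_trans (le_of_eq ?_) (h1.trans_eq (add_comm _ _))
          rw [← lintegral_const_mul' _ _ ENNReal.ofReal_ne_top]
          refine lintegral_congr fun ω => ?_
          rw [← ENNReal.ofReal_mul h0, mul_one_div]
    _ = ENNReal.ofReal A * volume (lowNoise σ t) +
          (ENNReal.ofReal η + ENNReal.ofReal (B * avgSd σ)) := by
        rw [lintegral_add_left (measurable_const.indicator hm), lintegral_add_left measurable_const,
          lintegral_indicator_const hm, Measure.restrict_apply hm, Set.inter_eq_left.2 hsub,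
          setLIntegral_const, volume_cube, mul_one, avgSd_eq, ← integral_const_mul,
          ofReal_integral_eq_lintegral_ofReal ((integrableOn_cube_of_continuousOn hσ).const_mul B)]
        filter_upwards [ae_restrict_mem measurableSet_cube] with x hx
        exact mul_nonneg hB0 (hσ0 x hx)
    _ ≤ ENNReal.ofReal W := by
        have hfin : volume (lowNoise σ t) ≠ ∞ :=
          ((measure_mono hsub).trans_lt (by simp [volume_cube])).ne
        have havg : 0 ≤ avgSd σ := by
          rw [avgSd_eq]; exact setIntegral_nonneg measurableSet_cube hσ0
        rw [← ofReal_measureReal hfin, ← ENNReal.ofReal_mul hA0,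
          ← ENNReal.ofReal_add hη0 (by positivity), ← ENNReal.ofReal_add (by positivity) (by positivity)]
        apply ENNReal.ofReal_le_ofReal
        linarith

end

/-! ### Assembly for large budgets. -/

section

variable {d n : ℕ}

/-- A globally measurable version of `σ`, which by itself is controlled only on the cube. -/
lemma measurable_indicator_cube {σ : Pt d → ℝ} (hσ : ContinuousOn σ (cube d)) :
    Measurable ((cube d).indicator σ) := by
  classical
  rw [← Set.piecewise_eq_indicator]
  exact hσ.measurable_piecewise continuous_zero.continuousOn measurableSet_cube

lemma NoiseCondition.congr {σmax : ℝ} {K : ℝ≥0} {θ₁ θ₂ : ℝ} {σ σ' : Pt d → ℝ}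
    {Q : ℕ → Kernel (Pt d) ℝ} (hN : NoiseCondition σmax K θ₁ θ₂ σ Q)
    (h : ∀ x ∈ cube d, σ x = σ' x) : NoiseCondition σmax K θ₁ θ₂ σ' Q where
  sd_nonneg x hx := h x hx ▸ hN.sd_nonneg x hx
  variance_le x hx := h x hx ▸ hN.variance_le x hx
  holder x hx y hy := by rw [← h x hx, ← h y hy]; exact hN.holder x hx y hy
  mean_zero := hN.mean_zero
  variance_eq i x hx := by rw [← h x hx]; exact hN.variance_eq i x hx
  subGaussian := hN.subGaussian

lemma pilotSize_le {c : ℝ} (hc' : c ≤ 1) : pilotSize c n ≤ n := by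
  refine Nat.floor_le_of_le ?_
  have : (0 : ℝ) ≤ n := by positivity
  nlinarith

/-- The floor and the halving together give `c n < 2m + 2`, and `c n ≥ 4` absorbs the loss. -/
lemma le_half_pilotSize {c : ℝ} (hcn : 4 ≤ c * n) :
    c * n / 4 ≤ ((pilotSize c n / 2 : ℕ) : ℝ) := by
  have h1 : c * n < pilotSize c n + 1 := Nat.lt_floor_add_one _
  have h2 : pilotSize c n ≤ 2 * (pilotSize c n / 2) + 1 := by omega
  have h3 : (pilotSize c n : ℝ) ≤ 2 * ((pilotSize c n / 2 : ℕ) : ℝ) + 1 := by exact_mod_cast h2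
  linarith

/-- The number of first-step covariates per unit of the squared inverse bandwidth. -/
def countConst (d : ℕ) (c : ℝ) : ℝ := c / (16 * 4 ^ d)

/-- The constant in the accuracy of the estimated standard deviation, in terms of the parameters of
the model. -/
def sdConst (d : ℕ) (σmax : ℝ) (K : ℝ≥0) (τ θ₂ L c : ℝ) : ℝ :=
  accuracyConst d σmax L τ θ₂ (8 * (K + 1) * (12 / countConst d c + 8))

/-- The constant that compares the integral of the estimated standard deviation with the average
noise level. -/
def massConst (d : ℕ) (σmax : ℝ) (K : ℝ≥0) (τ θ₂ L c c₁ : ℝ) : ℝ :=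
  1 + (sdConst d σmax K τ θ₂ L c + 2 * (L * Real.sqrt d ^ τ + 1)) / (1 - c₁)

variable {σmax : ℝ} {K : ℝ≥0} {τ θ₁ θ₂ τ₁ L c c₁ cr h : ℝ} {f σ : Pt d → ℝ}
  {Q : ℕ → Kernel (Pt d) ℝ}

lemma sdConst_nonneg (hL : 0 ≤ L) : 0 ≤ sdConst d σmax K τ θ₂ L c := accuracyConst_nonneg d hL

lemma massConst_pos (hL : 0 ≤ L) (hc₁ : c₁ < 1) : 0 < massConst d σmax K τ θ₂ L c c₁ := by
  have := sdConst_nonneg (d := d) (σmax := σmax) (K := K) (τ := τ) (θ₂ := θ₂) (c := c) hL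
  have h1 : 0 < 1 - c₁ := by linarith
  unfold massConst
  positivity

lemma NoiseCondition.sd_le (hN : NoiseCondition σmax K θ₁ θ₂ σ Q) (hσmax : 0 ≤ σmax) {x : Pt d}
    (hx : x ∈ cube d) : σ x ≤ σmax :=
  (abs_le_of_sq_le_sq' (hN.variance_le x hx) hσmax).2

variable [∀ i, IsMarkovKernel (Q i)]

/-- With high probability over the first step, the retrieval law gives to the ball around a point
of high noise a mass of order `σ z h ^ d / σ̄`. -/
lemma pilotLaw_retrievalLaw_lt_le (hN : NoiseCondition σmax K θ₁ θ₂ σ Q) (hσmax : 0 < σmax)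
    (hL : 0 ≤ L) (hτ : 0 < τ) (hθ₂ : 0 < θ₂) (hτ₁ : 0 ≤ τ₁) (hτ₁L : τ₁ ≤ L) (hθ₁ : 0 ≤ θ₁)
    (hθ₁L : θ₁ ≤ L) (hf : f ∈ HolderClass τ₁ τ (cube d)) (hc : 0 < c) (hc' : c < 1)
    (hn : 2 ≤ n) (hcn : 4 ≤ c * n) (hbc : 2 * sdBandwidth d n ≤ countConst d c)
    (hh : 0 < h) (hh1 : h ≤ 1) (hnh : 1 / 2 ≤ n * h ^ d) (hc₁' : c₁ < 1)
    {ρ : ℝ} (hρ : ρ = Real.log n *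
      (n : ℝ) ^ (-(min (2 * τ) (min θ₂ (1 / 2)) / (4 + 2 * (d : ℝ)))))
    (hσρ : (1 - c₁) * ρ ≤ avgSd σ) {z : Pt d} (hz : z ∈ cube d)
    (hσz : 0 < σ z) (hzρ : 4 * (sdConst d σmax K τ θ₂ L c * ρ) ≤ σ z)
    (hzh : 4 * (θ₁ * (Real.sqrt d * h) ^ θ₂) ≤ σ z) :
    pilotLaw (pilotSize c n) Q {D | retrievalLaw c n f (fun i => (extend D i).1)
      (fun i => (extend D i).2) {y | ‖y - z‖ ≤ h} <
        ENNReal.ofReal (σ z * h ^ d / (4 * (massConst d σmax K τ θ₂ L c c₁ * avgSd σ)))} ≤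
      ENNReal.ofReal (pilotConst d c σmax / n ^ 3) := by
  have hn0 : 0 < n := by omega
  have hnr : (0 : ℝ) < n := by exact_mod_cast hn0
  set b := sdBandwidth d n with hb
  have hb0 : 0 < b := sdBandwidth_pos hn0
  have hb1 : b ≤ 1 := sdBandwidth_le_one hn0
  have hc₃ : 0 < countConst d c := by unfold countConst; positivity
  have hσc : ContinuousOn σ (cube d) := HolderClass.continuousOn hN.holder hθ₁ hθ₂
  have hσ' : ∀ x ∈ cube d, σ x = (cube d).indicator σ x := fun x hx =>
    (Set.indicator_of_mem hx σ).symm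
  have hρb := hρ
  rw [rpow_rate_eq hn0, ← hb] at hρb
  have hρ1 : 1 / (2 * (n : ℝ)) ≤ ρ := hρ ▸ one_div_le_log_mul_rpow hn
  have hA0 : 0 ≤ sdConst d σmax K τ θ₂ L c := sdConst_nonneg hL
  have hc1 : 0 < 1 - c₁ := by linarith
  refine (measure_mono fun D hD => ?_).trans (pilotLaw_not_goodPilot_le (hN.congr hσ')
    (measurable_indicator_cube hσc) hc hb0 hb1 hn0 (mul_sdBandwidth_pow hn0)
    (Nat.div_le_self (pilotSize c n) 2) ((Nat.div_le_self _ 2).trans (pilotSize_le hc'.le))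
    (le_half_pilotSize hcn))
  intro hgood
  have hgood' := hgood.congr fun x hx => (hσ' x hx).symm
  refine not_lt.2 ?_ (Set.mem_ofPred_eq ▸ hD)
  have key := GoodPilot.le_normalizedLaw_sdEst_ball (c₃ := countConst d c) hgood' hσmax hL hτ hθ₂
    hτ₁ hτ₁L hθ₁ hθ₁L hf hN.holder hN.sd_nonneg (fun x hx => hN.sd_le hσmax.le hx) hn hb0 hb1 hc₃ hbc
    hh hh1 hnh hz hσz (by rw [← hρb]; exact hzρ) hzh
  refine le_trans (ENNReal.ofReal_le_ofReal ?_) key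
  rw [← hρb, ← avgSd_eq, ← sdConst]
  have hρ0 : 0 < ρ := lt_of_lt_of_le (by positivity) hρ1
  have havg : 0 < avgSd σ := lt_of_lt_of_le (by positivity) hσρ
  have h1 : ρ ≤ avgSd σ / (1 - c₁) := by rw [le_div_iff₀ hc1]; linarith
  have h2 : (L * Real.sqrt d ^ τ + 1) / n ≤ 2 * (L * Real.sqrt d ^ τ + 1) * ρ := by
    have h0 : 0 ≤ L * Real.sqrt d ^ τ + 1 := by positivity
    calc (L * Real.sqrt d ^ τ + 1) / n = 2 * (L * Real.sqrt d ^ τ + 1) * (1 / (2 * n)) := by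
          field_simp
      _ ≤ _ := by gcongr
  -- Both error terms are multiples of `ρ`, and `ρ ≤ σ̄ / (1 - c₁)`; so the normalizing integral is
  -- at most a constant times `σ̄`.
  have h3 : avgSd σ + sdConst d σmax K τ θ₂ L c * ρ + (L * Real.sqrt d ^ τ + 1) / n ≤
      massConst d σmax K τ θ₂ L c c₁ * avgSd σ := by
    calc _ ≤ avgSd σ + (sdConst d σmax K τ θ₂ L c + 2 * (L * Real.sqrt d ^ τ + 1)) * ρ := by
          linarith
      _ ≤ avgSd σ + (sdConst d σmax K τ θ₂ L c + 2 * (L * Real.sqrt d ^ τ + 1)) *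
            (avgSd σ / (1 - c₁)) := by gcongr
      _ = _ := by rw [massConst]; ring
  have h4 : 0 ≤ (L * Real.sqrt d ^ τ + 1) / n := by positivity
  gcongr

/-- The variance bound for a large sampling budget. -/
lemma varianceTerm_Ico_le (hN : NoiseCondition σmax K θ₁ θ₂ σ Q) (hσmax : 0 < σmax)
    (hL : 0 ≤ L) (hτ : 0 < τ) (hθ₂ : 0 < θ₂) (hτ₁ : 0 ≤ τ₁) (hτ₁L : τ₁ ≤ L) (hθ₁ : 0 ≤ θ₁)
    (hθ₁L : θ₁ ≤ L) (hf : f ∈ HolderClass τ₁ τ (cube d)) (hc : 0 < c) (hc' : c < 1)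
    (hn : 2 ≤ n) (hcn : 4 ≤ c * n) (hbc : 2 * sdBandwidth d n ≤ countConst d c)
    (hh : 0 < h) (hh1 : h ≤ 1) (hc₁' : c₁ < 1) (hcr1 : 1 ≤ cr)
    (hcrA : 4 * sdConst d σmax K τ θ₂ L c ≤ cr) (hcrd : 4 * Real.sqrt d ^ θ₂ ≤ cr)
    (havg : (1 - c₁) * (cr * rateTilde d n σmax τ θ₁ θ₂ h) ≤ avgSd σ)
    (hlow : volume.real (lowNoise σ (cr * rateTilde d n σmax τ θ₁ θ₂ h)) ≤
      avgSd σ ^ 2 / (rateTilde d n σmax τ θ₁ θ₂ h ^ 2 * n * h ^ d))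
    {Ω : Type*} [MeasurableSpace Ω] {P : Measure Ω} [IsProbabilityMeasure P]
    {x : ℕ → Ω → Pt d} {ε : ℕ → Ω → ℝ} (hS : IsRetrievalSample P c n f Q x ε) :
    varianceTerm P x (Finset.Ico (pilotSize c n) n) σ σmax θ₁ θ₂ h ≤
      ENNReal.ofReal ((cr ^ 2 + 1 + 16 * massConst d σmax K τ θ₂ L c c₁ / (1 - c) +
        8 * σmax ^ 2 * pilotConst d c σmax / (1 - c₁) ^ 2) * (avgSd σ ^ 2 / (n * h ^ d))) := by
  have hnr : (0 : ℝ) < n := by exact_mod_cast (by omega : 0 < n)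
  have hc1 : 0 < 1 - c₁ := by linarith
  have hcc : 0 < 1 - c := by linarith
  have hσc : ContinuousOn σ (cube d) := HolderClass.continuousOn hN.holder hθ₁ hθ₂
  have hhd : 0 < h ^ d := by positivity
  have hhd1 : h ^ d ≤ 1 := pow_le_one₀ hh.le hh1
  set ρ := Real.log n * (n : ℝ) ^ (-(min (2 * τ) (min θ₂ (1 / 2)) / (4 + 2 * (d : ℝ)))) with hρ
  set r := rate d n σmax θ₁ θ₂ h with hr
  set R := rateTilde d n σmax τ θ₁ θ₂ h with hR
  have hRr : R = r + ρ := rfl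
  have hρ1 : 1 / (2 * (n : ℝ)) ≤ ρ := one_div_le_log_mul_rpow hn
  have hρ0 : 0 < ρ := lt_of_lt_of_le (by positivity) hρ1
  have hr0 : 0 ≤ r := (Real.sqrt_nonneg _).trans (le_max_left _ _)
  have hR0 : 0 < R := by linarith
  have hR2 : σmax * θ₁ * h ^ θ₂ ≤ R ^ 2 := by
    have h1 : Real.sqrt (σmax * θ₁ * h ^ θ₂) ≤ R := (le_max_left _ _).trans (by linarith : r ≤ R)
    exact (Real.sqrt_le_iff.1 h1).2
  have hu0 : 0 ≤ σmax * θ₁ * h ^ θ₂ := by positivity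
  have havgR : (1 - c₁) * R ≤ avgSd σ := by
    refine le_trans ?_ havg
    have : R ≤ cr * R := le_mul_of_one_le_left hR0.le hcr1
    gcongr
  have havgρ : (1 - c₁) * ρ ≤ avgSd σ := le_trans (by gcongr; linarith) havgR
  have havg0 : 0 < avgSd σ := lt_of_lt_of_le (by positivity) havgρ
  set M := massConst d σmax K τ θ₂ L c c₁ with hM
  have hM0 : 0 < M := massConst_pos hL hc₁'
  set Cp := pilotConst d c σmax with hCp
  have hCp0 : 0 < Cp := pilotConst_pos d hc σmax
  have hA0 : 0 ≤ sdConst d σmax K τ θ₂ L c := sdConst_nonneg hL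
  -- `A` bounds the numerator on the low-noise set; `B` comes from `2σ(z)²` times the inverse
  -- binomial moment, where one factor `σ(z)` cancels against the ball mass; `η` is the cost of bad
  -- first-step data.
  refine varianceTerm_le_of_lowNoise P x _ hσc hN.sd_nonneg (t := cr * R)
    (A := (cr ^ 2 + 1) * R ^ 2) (B := 16 * M / (1 - c) * (avgSd σ / (n * h ^ d)))
    (η := 2 * σmax ^ 2 * (Cp / n ^ 3)) (by positivity) (by positivity) (by positivity) ?_ ?_ ?_
  · rintro z ⟨hz, hzt⟩
    have h1 := hN.sd_nonneg z hz
    have h2 : σ z ^ 2 ≤ (cr * R) ^ 2 := by gcongr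
    linarith [h2, hR2, mul_pow cr R 2]
  · intro z hz hzt
    have hσzR : R < σ z := (le_mul_of_one_le_left hR0.le hcr1).trans_lt hzt
    have hσz : 0 < σ z := hR0.trans hσzR
    have hσzm : σ z ≤ σmax := hN.sd_le hσmax.le hz
    -- A point with `σ z > R` exists only if `σmax log n / (n h^d) ≤ σmax`, which forces `n h^d ≥
    -- log n ≥ 1/2`.
    have hnh : 1 / 2 ≤ n * h ^ d := by
      have h1 : σmax * Real.log n / (n * h ^ d) ≤ R :=
        (le_max_right _ _).trans (by linarith : r ≤ R)
      have h2 : σmax * Real.log n / (n * h ^ d) ≤ σmax := h1.trans (hσzR.le.trans hσzm)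
      rw [div_le_iff₀ (by positivity)] at h2
      exact (half_le_log hn).trans (le_of_mul_le_mul_left h2 hσmax)
    have hzρ : 4 * (sdConst d σmax K τ θ₂ L c * ρ) ≤ σ z := by
      calc 4 * (sdConst d σmax K τ θ₂ L c * ρ) = 4 * sdConst d σmax K τ θ₂ L c * ρ := by ring
        _ ≤ cr * R := by gcongr; linarith
        _ ≤ σ z := hzt.le
    -- The threshold controls `σmax θ₁ h^θ₂` by `R²`. Multiplying the goal by `σmax` and using `R ≤
    -- σmax` turns this into a bound on the oscillation of `σ` over the ball.
    have hzh : 4 * (θ₁ * (Real.sqrt d * h) ^ θ₂) ≤ σ z := by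
      rw [Real.mul_rpow (Real.sqrt_nonneg _) hh.le]
      have h1 : σmax * (4 * (θ₁ * (Real.sqrt d ^ θ₂ * h ^ θ₂))) ≤ σmax * σ z := by
        calc σmax * (4 * (θ₁ * (Real.sqrt d ^ θ₂ * h ^ θ₂))) =
              (4 * Real.sqrt d ^ θ₂) * (σmax * θ₁ * h ^ θ₂) := by ring
          _ ≤ cr * R ^ 2 := by gcongr
          _ = (cr * R) * R := by ring
          _ ≤ σ z * σmax := mul_le_mul hzt.le (hσzR.le.trans hσzm) hR0.le hσz.le
          _ = _ := by ring
      exact le_of_mul_le_mul_left h1 hσmax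
    have hbad := pilotLaw_retrievalLaw_lt_le hN hσmax hL hτ hθ₂ hτ₁ hτ₁L hθ₁ hθ₁L hf hc hc' hn hcn
      hbc hh hh1 hnh hc₁' hρ havgρ hz hσz hzρ hzh
    set p := σ z * h ^ d / (4 * (M * avgSd σ)) with hp
    have hp0 : 0 < p := by positivity
    have hinv := hS.lintegral_inv_localCount_le z h hp0 hbad
    refine ⟨by positivity, ?_⟩
    have hnum : σ z ^ 2 + σmax * θ₁ * h ^ θ₂ ≤ 2 * σ z ^ 2 := by
      have : R ^ 2 ≤ σ z ^ 2 := by gcongr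
      linarith
    refine (mul_le_mul' (ENNReal.ofReal_le_ofReal hnum) hinv).trans ?_
    rw [← ENNReal.ofReal_add (by positivity) (by positivity), ← ENNReal.ofReal_mul (by positivity),
      ← ENNReal.ofReal_add (by positivity) (by positivity)]
    apply ENNReal.ofReal_le_ofReal
    rw [mul_add]
    refine add_le_add ?_ ?_
    · have hcard : (1 - c) * n ≤ ((Finset.Ico (pilotSize c n) n).card : ℝ) + 1 := by
        rw [Nat.card_Ico, Nat.cast_sub (pilotSize_le hc'.le)]
        have : (pilotSize c n : ℝ) ≤ c * n := Nat.floor_le (by positivity)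
        linarith
      calc 2 * σ z ^ 2 * (2 / (((Finset.Ico (pilotSize c n) n).card + 1) * p)) ≤
            2 * σ z ^ 2 * (2 / (((1 - c) * n) * p)) := by gcongr
        _ = _ := by rw [hp]; field_simp; ring
    · gcongr
  · have hX : (cr ^ 2 + 1) * R ^ 2 * volume.real (lowNoise σ (cr * R)) ≤
        (cr ^ 2 + 1) * (avgSd σ ^ 2 / (n * h ^ d)) := by
      calc _ ≤ (cr ^ 2 + 1) * R ^ 2 * (avgSd σ ^ 2 / (R ^ 2 * n * h ^ d)) := by gcongr
        _ = _ := by field_simp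
    -- Uses `σ̄ ≥ (1 - c₁) / (2n)` and `h^d ≤ 1`.
    have hY : 2 * σmax ^ 2 * (Cp / n ^ 3) ≤
        8 * σmax ^ 2 * Cp / (1 - c₁) ^ 2 * (avgSd σ ^ 2 / (n * h ^ d)) := by
      have h1 : (1 - c₁) * (1 / (2 * n)) ≤ avgSd σ := le_trans (by gcongr) havgρ
      calc 2 * σmax ^ 2 * (Cp / n ^ 3) = 8 * σmax ^ 2 * Cp / (1 - c₁) ^ 2 *
            (((1 - c₁) * (1 / (2 * n))) ^ 2 / (n * 1)) := by field_simp; ring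
        _ ≤ _ := by gcongr
    have hZ : 16 * M / (1 - c) * (avgSd σ / (n * h ^ d)) * avgSd σ =
        16 * M / (1 - c) * (avgSd σ ^ 2 / (n * h ^ d)) := by ring
    rw [hZ, add_mul, add_mul]
    linarith

end

end Retrieval

end

/-! ### Choice of constants and the case of small budgets. -/

open Retrieval
theorem lemma2 (d : ℕ) (hd : 1 ≤ d)
    (σmax : ℝ) (hσmax : 0 < σmax) (K : ℝ≥0)
    (τ : ℝ) (hτ : 0 < τ) (hτ' : τ ≤ 1) (θ₂ : ℝ) (hθ₂ : 0 < θ₂)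
    (L : ℝ) (hL : 0 ≤ L)
    (c : ℝ) (hc : 0 < c) (hc' : c < 1) (c₀ : ℝ) (hc₀ : 0 ≤ c₀)
    (c₁ : ℝ) (hc₁ : 0 < c₁) (hc₁' : c₁ < 1) :
    ∃ cr₀ : ℝ, 0 < cr₀ ∧ ∀ cr : ℝ, cr₀ ≤ cr → ∃ C : ℝ, 0 < C ∧
      ∀ (n : ℕ), 2 ≤ n → ∀ (h : ℝ), h = (n : ℝ) ^ (-c₀) →
      ∀ (τ₁ : ℝ), 0 ≤ τ₁ → τ₁ ≤ L → ∀ (θ₁ : ℝ), 0 ≤ θ₁ → θ₁ ≤ L →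
      ∀ (f : Pt d → ℝ), f ∈ HolderClass τ₁ τ (cube d) →
      ∀ (σ : Pt d → ℝ) (Q : ℕ → Kernel (Pt d) ℝ) (_ : ∀ i, IsMarkovKernel (Q i)),
        NoiseCondition σmax K θ₁ θ₂ σ Q →
        volume.real (lowNoise σ (cr * rateTilde d n σmax τ θ₁ θ₂ h)) ≤
          c₁ * min (avgSd σ ^ 2 / (rateTilde d n σmax τ θ₁ θ₂ h ^ 2 * n * h ^ d)) 1 →
      ∀ (Ω : Type*) [MeasurableSpace Ω] (P : Measure Ω) [IsProbabilityMeasure P]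
        (x : ℕ → Ω → Pt d) (ε : ℕ → Ω → ℝ), IsRetrievalSample P c n f Q x ε →
        varianceTerm P x (Finset.range n) σ σmax θ₁ θ₂ h ≤
            ENNReal.ofReal (C * (avgSd σ ^ 2 / (n * h ^ d))) ∧
        varianceTerm P x (Finset.Ico (pilotSize c n) n) σ σmax θ₁ θ₂ h ≤
            ENNReal.ofReal (C * (avgSd σ ^ 2 / (n * h ^ d))) := by
  have hA0 : 0 ≤ sdConst d σmax K τ θ₂ L c := sdConst_nonneg hL
  have hd0 : 0 ≤ Real.sqrt d ^ θ₂ := Real.rpow_nonneg (Real.sqrt_nonneg _) _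
  -- The three summands ensure in turn `cr ≥ 1`, domination of the estimation error, and domination
  -- of the oscillation of `σ` over a ball of radius `h`.
  refine ⟨1 + 4 * sdConst d σmax K τ θ₂ L c + 4 * Real.sqrt d ^ θ₂, by positivity,
    fun cr hcr => ?_⟩
  have hc1 : 0 < 1 - c₁ := by linarith
  have hcc : 0 < 1 - c := by linarith
  have hc₃ : 0 < countConst d c := by unfold countConst; positivity
  set C₁ : ℝ := cr ^ 2 + 1 + 16 * massConst d σmax K τ θ₂ L c c₁ / (1 - c) +
    8 * σmax ^ 2 * pilotConst d c σmax / (1 - c₁) ^ 2 with hC₁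
  have hM0 : 0 < massConst d σmax K τ θ₂ L c c₁ := massConst_pos hL hc₁'
  have hCp0 := pilotConst_pos d hc σmax
  have hC₁0 : 0 < C₁ := by positivity
  -- Beyond `N₀` the half sample has at least `c n / 4` points and, on good data, the total kernel
  -- weight is at least one everywhere on the cube.
  set N₀ : ℝ := 4 / c + (2 / countConst d c) ^ (d + 2) with hN₀
  set C₂ : ℝ := (σmax ^ 2 + σmax * L) * (4 * N₀ ^ 3 / (1 - c₁) ^ 2) with hC₂
  have hN₀0 : 0 < N₀ := by positivity
  have hC₂0 : 0 < C₂ := by positivity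
  refine ⟨C₁ + C₂, by positivity, ?_⟩
  intro n hn h hh τ₁ hτ₁ hτ₁L θ₁ hθ₁ hθ₁L f hf σ Q _ hN hlow Ω _ P _ x ε hS
  have hn0 : 0 < n := by omega
  have hnr : (0 : ℝ) < n := by exact_mod_cast hn0
  have hh0 : 0 < h := hh ▸ Real.rpow_pos_of_pos hnr _
  have hh1 : h ≤ 1 := by
    rw [hh]
    exact Real.rpow_le_one_of_one_le_of_nonpos (by exact_mod_cast hn0) (by linarith)
  suffices hmain : varianceTerm P x (Finset.Ico (pilotSize c n) n) σ σmax θ₁ θ₂ h ≤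
      ENNReal.ofReal ((C₁ + C₂) * (avgSd σ ^ 2 / (n * h ^ d))) by
    refine ⟨le_trans (varianceTerm_anti P x ?_ σ hσmax.le hθ₁ hh0.le) hmain, hmain⟩
    intro i hi
    exact Finset.mem_range.2 (Finset.mem_Ico.1 hi).2
  have hσc : ContinuousOn σ (cube d) := HolderClass.continuousOn hN.holder hθ₁ hθ₂
  set R := rateTilde d n σmax τ θ₁ θ₂ h with hR
  have hR1 : 1 / (2 * (n : ℝ)) ≤ R := by
    have h1 : 0 ≤ rate d n σmax θ₁ θ₂ h := (Real.sqrt_nonneg _).trans (le_max_left _ _)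
    exact (one_div_le_log_mul_rpow hn).trans (le_add_of_nonneg_left h1)
  have hR0 : 0 < R := lt_of_lt_of_le (by positivity) hR1
  have hcr1 : 1 ≤ cr := by linarith
  -- Only the entry `1` of the minimum is used: outside a set of volume at most `c₁` the noise level
  -- exceeds `cr * R`.
  have havg : (1 - c₁) * (cr * R) ≤ avgSd σ :=
    le_avgSd_of_volume_lowNoise_le hσc hN.sd_nonneg (by positivity)
      (hlow.trans (mul_le_of_le_one_right hc₁.le (min_le_right _ _)))
  have hq0 : 0 ≤ avgSd σ ^ 2 / (n * h ^ d) := by positivity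
  by_cases hbig : 4 / c ≤ n ∧ (2 / countConst d c) ^ (d + 2) ≤ n
  · have hcn : 4 ≤ c * n := by
      have := (div_le_iff₀ hc).1 hbig.1
      linarith
    have hbc : 2 * sdBandwidth d n ≤ countConst d c := by
      have h1 := mul_sdBandwidth_pow (d := d) hn0
      have hb := sdBandwidth_pos (d := d) hn0
      have h2 : (2 * sdBandwidth d n / countConst d c) ^ (d + 2) ≤ 1 := by
        calc _ = (2 / countConst d c) ^ (d + 2) * sdBandwidth d n ^ (d + 2) := by
              rw [← mul_pow]; ring
          _ ≤ n * sdBandwidth d n ^ (d + 2) := by gcongr; exact hbig.2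
          _ = 1 := h1
      have h3 := (pow_le_one_iff_of_nonneg (by positivity) (by omega)).1 h2
      exact (div_le_one hc₃).1 h3
    have hlow' : volume.real (lowNoise σ (cr * R)) ≤ avgSd σ ^ 2 / (R ^ 2 * n * h ^ d) := by
      refine hlow.trans ?_
      have h1 : 0 ≤ min (avgSd σ ^ 2 / (R ^ 2 * n * h ^ d)) 1 :=
        le_min (by positivity) zero_le_one
      exact (mul_le_of_le_one_left h1 hc₁'.le).trans (min_le_left _ _)
    refine (varianceTerm_Ico_le hN hσmax hL hτ hθ₂ hτ₁ hτ₁L hθ₁ hθ₁L hf hc hc' hn hcn hbc hh0 hh1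
      hc₁' hcr1 (by linarith) (by linarith) havg hlow' hS).trans ?_
    rw [← hC₁]
    exact ENNReal.ofReal_le_ofReal (mul_le_mul_of_nonneg_right (by linarith) hq0)
  · have hnN : (n : ℝ) ≤ N₀ := by
      have h1 : 0 < 4 / c := by positivity
      have h2 : 0 < (2 / countConst d c) ^ (d + 2) := by positivity
      by_contra hlt
      exact hbig ⟨by linarith, by linarith⟩
    -- For `n ≤ N₀` the numerator alone is bounded, while the target is at least of order `n⁻³ ≥
    -- N₀⁻³`.
    refine (varianceTerm_le_of_le P x _ (A := σmax ^ 2 + σmax * L) (fun z hz => ?_)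
      (by positivity)).trans ?_
    · have h1 : h ^ θ₂ ≤ 1 := Real.rpow_le_one hh0.le hh1 hθ₂.le
      have h2 : σmax * θ₁ * h ^ θ₂ ≤ σmax * L * 1 := by gcongr
      linarith [hN.variance_le z hz]
    · apply ENNReal.ofReal_le_ofReal
      have h1 : (1 - c₁) * (1 / (2 * n)) ≤ avgSd σ := by
        refine le_trans ?_ havg
        have : R ≤ cr * R := le_mul_of_one_le_left hR0.le hcr1
        gcongr
        exact hR1.trans this
      have hhd1 : h ^ d ≤ 1 := pow_le_one₀ hh0.le hh1
      have hhd : 0 < h ^ d := by positivity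
      calc σmax ^ 2 + σmax * L = (σmax ^ 2 + σmax * L) * (4 * (n : ℝ) ^ 3 / (1 - c₁) ^ 2) *
            (((1 - c₁) * (1 / (2 * n))) ^ 2 / (n * 1)) := by field_simp; ring
        _ ≤ (σmax ^ 2 + σmax * L) * (4 * N₀ ^ 3 / (1 - c₁) ^ 2) *
            (avgSd σ ^ 2 / (n * h ^ d)) := by gcongr
        _ ≤ _ := by
            rw [← hC₂]
            gcongr
            linarith
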